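/- Let $N \ge 1$ and $1 \le p < \infty$. A closed half-space of $\mathbf{R}^N$ is a set $H = \{x : \langle \nu, x\rangle \le b\}$ with $|\nu| = 1$ and $b \in \mathbf{R}$; the set $\mathcal{H}$ of closed half-spaces carries the topology of the parameters $(\nu, b)$, in which $G_n \to G$ if and only if there are isometries $i_n$ of $\mathbf{R}^N$ that converge pointwise to the identity and satisfy $G_n = i_n(G)$. Let $\sigma_H$ be the reflection with respect to $\partial H$. The polarization $u^H$ of $u : \mathbf{R}^N \to \mathbf{R}$ is defined by $u^H(x) = \max(u(x), u(\sigma_H(x)))$ if $x \in H$ and $u^H(x) = \min(u(x), u(\sigma_H(x)))$ if $x \notin H$, and $u^{H_1 H_2 \cdots H_n} = (\cdots((u^{H_1})^{H_2})\cdots)^{H_n}$. The Schwarz symmetrization of a nonnegative $u \in L^p(\mathbf{R}^N)$ is the unique function $u^* : \mathbf{R}^N \to [0, \infty]$ such that for every $\lambda > 0$ the set $\{u^* > \lambda\}$ is an open ball $B(0, R)$ with $R \ge 0$ and has the same Lebesgue measure as $\{u > \lambda\}$. Let $(H_n)_{n \ge 1}$ be a sequence of closed half-spaces of $\mathbf{R}^N$,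 each of which contains $0$ in its interior, and suppose that $(H_n)_{n \ge 1}$ is dense in the set of closed half-spaces containing $0$. Let $u \in L^p(\mathbf{R}^N)$ be nonnegative, and define $u_0 = u$ and $u_{n+1} = u_n^{H_1 H_2 \cdots H_{n+1}}$ for $n \ge 0$. Then $u^*$ and all the $u_n$ belong to $L^p(\mathbf{R}^N)$, and $u_n \to u^*$ in $L^p(\mathbf{R}^N)$ as $n \to \infty$. -/

import Mathlib

open MeasureTheory Filter Topology
open scoped ENNReal

/-- A closed half-space `{x | ⟪ν, x⟫ ≤ b}` of `ℝ^N`, given by its outer unit normal `ν` and its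
offset `b`. These data are determined by the set (`ClosedHalfSpace.carrier_injective`). -/
structure ClosedHalfSpace (N : ℕ) where
  /-- the outer unit normal -/
  normal : EuclideanSpace ℝ (Fin N)
  norm_normal : ‖normal‖ = 1
  /-- the offset -/
  offset : ℝ

namespace ClosedHalfSpace

/-- The set of points of the half-space. -/
def carrier {N : ℕ} (H : ClosedHalfSpace N) : Set (EuclideanSpace ℝ (Fin N)) :=
  {x | inner ℝ H.normal x ≤ H.offset}

/-- The reflection `σ_H` of `ℝ^N` with respect to the hyperplane `∂H`. -/
noncomputable def reflect {N : ℕ} (H : ClosedHalfSpace N) (x : EuclideanSpace ℝ (Fin N)) :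
    EuclideanSpace ℝ (Fin N) :=
  x - (2 * (inner ℝ H.normal x - H.offset)) • H.normal

/-- The topology on the set of closed half-spaces. A sequence `H n` converges to `G` if and only
if `H n = i n (G)` for isometries `i n` converging to the identity
(`ClosedHalfSpace.tendsto_iff_exists_isometry`). -/
instance {N : ℕ} : TopologicalSpace (ClosedHalfSpace N) :=
  TopologicalSpace.induced (fun H => (H.normal, H.offset)) inferInstance

theorem carrier_injective {N : ℕ} :
    Function.Injective (carrier : ClosedHalfSpace N → Set (EuclideanSpace ℝ (Fin N))) := by
  rintro ⟨ν, hν, b⟩ ⟨μ, hμ, c⟩ h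
  have key : ∀ x, inner ℝ ν x ≤ b ↔ inner ℝ μ x ≤ c := fun x => Set.ext_iff.1 h x
  have hνν : inner ℝ ν ν = (1 : ℝ) := by rw [real_inner_self_eq_norm_sq, hν]; norm_num
  have hμμ : inner ℝ μ μ = (1 : ℝ) := by rw [real_inner_self_eq_norm_sq, hμ]; norm_num
  set d : ℝ := inner ℝ ν μ with hd
  have hd' : inner ℝ μ ν = d := real_inner_comm _ _
  have h1 : 1 - d ^ 2 = 0 := by
    by_contra hne
    have := (key (b • ν + ((c + 1 - b * d) / (1 - d ^ 2)) • (μ - d • ν))).1 (by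
      simp only [inner_add_right, inner_smul_right, inner_sub_right, hνν, ← hd]
      linarith)
    simp only [inner_add_right, inner_smul_right, inner_sub_right, hμμ, hd'] at this
    rw [show (1 : ℝ) - d * d = 1 - d ^ 2 by ring, div_mul_cancel₀ _ hne] at this
    linarith
  have h2 : d = 1 := by
    by_contra hne
    have h3 : d = -1 := by
      rcases mul_eq_zero.1 (show (1 - d) * (1 + d) = 0 by linarith) with h4 | h4
      · exact absurd (by linarith) hne
      · linarith
    have := (key ((-(|b| + |c| + 1)) • ν)).1 (by
      rw [inner_smul_right, hνν]
      linarith [neg_abs_le b, abs_nonneg c])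
    rw [inner_smul_right, hd', h3] at this
    linarith [le_abs_self c, abs_nonneg b]
  have h3 : ν = μ := (inner_eq_one_iff_of_norm_eq_one hν hμ).1 h2
  subst h3
  have h4 : b = c := by
    apply le_antisymm
    · have := (key (b • ν)).1 (by rw [inner_smul_right, hνν]; linarith)
      rw [inner_smul_right, hνν] at this
      linarith
    · have := (key (c • ν)).2 (by rw [inner_smul_right, hνν]; linarith)
      rw [inner_smul_right, hνν] at this
      linarith
  subst h4
  rfl

theorem tendsto_iff {N : ℕ} {H : ℕ → ClosedHalfSpace N} {G : ClosedHalfSpace N} :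
    Tendsto H atTop (𝓝 G) ↔ Tendsto (fun n => (H n).normal) atTop (𝓝 G.normal) ∧
      Tendsto (fun n => (H n).offset) atTop (𝓝 G.offset) := by
  rw [nhds_induced, tendsto_comap_iff, nhds_prod_eq]
  exact Filter.tendsto_prod_iff'

theorem tendsto_iff_exists_isometry {N : ℕ} {H : ℕ → ClosedHalfSpace N} {G : ClosedHalfSpace N} :
    Tendsto H atTop (𝓝 G) ↔
      ∃ i : ℕ → (EuclideanSpace ℝ (Fin N) ≃ᵢ EuclideanSpace ℝ (Fin N)),
        (∀ n, (H n).carrier = i n '' G.carrier) ∧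
          ∀ x, Tendsto (fun n => i n x) atTop (𝓝 x) := by
  have hGG : inner ℝ G.normal G.normal = (1 : ℝ) := by
    rw [real_inner_self_eq_norm_sq, G.norm_normal]; norm_num
  rw [tendsto_iff]
  constructor
  · rintro ⟨h1, h2⟩
    let s : ℕ → EuclideanSpace ℝ (Fin N) := fun n => G.normal + (H n).normal
    let L : ℕ → (EuclideanSpace ℝ (Fin N) ≃ₗᵢ[ℝ] EuclideanSpace ℝ (Fin N)) := fun n =>
      ((ℝ ∙ G.normal)ᗮ.reflection).trans ((ℝ ∙ s n)ᗮ.reflection)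
    have hL : ∀ n, L n G.normal = (H n).normal := by
      intro n
      have e1 : (ℝ ∙ G.normal)ᗮ.reflection G.normal = -G.normal :=
        Submodule.reflection_orthogonalComplement_singleton_eq_neg _
      have e2 : (ℝ ∙ (G.normal - -(H n).normal))ᗮ.reflection G.normal = -(H n).normal :=
        Submodule.reflection_sub (by rw [norm_neg, G.norm_normal, (H n).norm_normal])
      simp only [L, s, LinearIsometryEquiv.trans_apply, e1, map_neg]
      rw [sub_neg_eq_add] at e2
      rw [e2, neg_neg]
    have hrefl : ∀ v y : EuclideanSpace ℝ (Fin N),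
        (ℝ ∙ v)ᗮ.reflection y = y - (2 * (inner ℝ v y / ‖v‖ ^ 2)) • v := by
      intro v y
      rw [Submodule.reflection_orthogonal_apply, Submodule.reflection_singleton_apply]
      simp only [RCLike.ofReal_real_eq_id, id_eq, two_smul, two_mul, add_smul]
      abel
    refine ⟨fun n => (L n).toIsometryEquiv.trans
      (IsometryEquiv.addRight (((H n).offset - G.offset) • (H n).normal)), ?_, ?_⟩
    · intro n
      have hHH : inner ℝ (H n).normal (H n).normal = (1 : ℝ) := by
        rw [real_inner_self_eq_norm_sq, (H n).norm_normal]; norm_num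
      ext y
      rw [Set.mem_image]
      constructor
      · intro hy
        refine ⟨(L n).symm (y - ((H n).offset - G.offset) • (H n).normal), ?_, by simp⟩
        have hy' : inner ℝ (H n).normal y ≤ (H n).offset := hy
        change inner ℝ G.normal _ ≤ G.offset
        rw [← LinearIsometryEquiv.inner_map_map (L n), hL, LinearIsometryEquiv.apply_symm_apply,
          inner_sub_right, inner_smul_right, hHH]
        linarith
      · rintro ⟨x, hx, rfl⟩
        have hx' : inner ℝ G.normal x ≤ G.offset := hx
        change inner ℝ (H n).normal (L n x + ((H n).offset - G.offset) • (H n).normal) ≤ _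
        rw [inner_add_right, inner_smul_right, hHH, ← hL n, LinearIsometryEquiv.inner_map_map]
        linarith
    · intro x
      have hs : Tendsto s atTop (𝓝 (G.normal + G.normal)) := tendsto_const_nhds.add h1
      have hs0 : ‖G.normal + G.normal‖ ^ 2 ≠ 0 := by
        rw [← two_smul ℝ, norm_smul, G.norm_normal]; norm_num
      have hlim : (ℝ ∙ (G.normal + G.normal))ᗮ.reflection ((ℝ ∙ G.normal)ᗮ.reflection x) = x := by
        have hsp : (ℝ ∙ (G.normal + G.normal)) = (ℝ ∙ G.normal) := by
          rw [← two_smul ℝ]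
          exact Submodule.span_singleton_smul_eq (by norm_num : IsUnit (2 : ℝ)) _
        have : ∀ z, (ℝ ∙ (G.normal + G.normal))ᗮ.reflection z = (ℝ ∙ G.normal)ᗮ.reflection z := by
          intro z
          congr!
        rw [this, Submodule.reflection_reflection]
      have hR : Tendsto (fun n => L n x) atTop (𝓝 x) := by
        have : Tendsto (fun n => (ℝ ∙ s n)ᗮ.reflection ((ℝ ∙ G.normal)ᗮ.reflection x)) atTop
            (𝓝 ((ℝ ∙ (G.normal + G.normal))ᗮ.reflection ((ℝ ∙ G.normal)ᗮ.reflection x))) := by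
          simp only [hrefl (s _), hrefl (G.normal + G.normal)]
          exact tendsto_const_nhds.sub
            ((((hs.inner tendsto_const_nhds).div (hs.norm.pow 2) hs0).const_mul 2).smul hs)
        rwa [hlim] at this
      have hT := hR.add ((h2.sub_const G.offset).smul h1)
      simpa using hT
  · rintro ⟨i, hi, hlim⟩
    let A : ℕ → (EuclideanSpace ℝ (Fin N) ≃ᵃⁱ[ℝ] EuclideanSpace ℝ (Fin N)) := fun n =>
      (i n).toRealAffineIsometryEquiv
    have hA : ∀ n x, A n x = i n x := fun n x => rfl
    have hlin : ∀ n x y, (A n).linearIsometryEquiv (x - y) = i n x - i n y := by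
      intro n x y
      exact (A n).map_vsub x y
    have hK : ∀ n, H n = ⟨(A n).linearIsometryEquiv G.normal,
        by rw [LinearIsometryEquiv.norm_map, G.norm_normal],
        inner ℝ ((A n).linearIsometryEquiv G.normal) (i n (G.offset • G.normal))⟩ := by
      intro n
      apply carrier_injective
      rw [hi n]
      ext y
      rw [Set.mem_image]
      have hval : ∀ x, inner ℝ ((A n).linearIsometryEquiv G.normal) (i n x) =
          inner ℝ ((A n).linearIsometryEquiv G.normal) (i n (G.offset • G.normal)) +
            (inner ℝ G.normal x - G.offset) := by
        intro x
        have := hlin n x (G.offset • G.normal)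
        rw [eq_sub_iff_add_eq] at this
        rw [← this, inner_add_right, LinearIsometryEquiv.inner_map_map, inner_sub_right,
          inner_smul_right, hGG]
        ring
      constructor
      · rintro ⟨x, hx, rfl⟩
        have hx' : inner ℝ G.normal x ≤ G.offset := hx
        change inner ℝ _ (i n x) ≤ _
        rw [hval x]
        dsimp only
        linarith
      · intro hy
        refine ⟨(i n).symm y, ?_, by simp⟩
        have hy' : inner ℝ ((A n).linearIsometryEquiv G.normal) y ≤
          inner ℝ ((A n).linearIsometryEquiv G.normal) (i n (G.offset • G.normal)) := hy
        have := hval ((i n).symm y)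
        rw [IsometryEquiv.apply_symm_apply] at this
        change inner ℝ G.normal _ ≤ G.offset
        linarith
    have hnormal : Tendsto (fun n => (A n).linearIsometryEquiv G.normal) atTop
        (𝓝 G.normal) := by
      have : ∀ n, (A n).linearIsometryEquiv G.normal = i n G.normal - i n 0 := fun n => by
        rw [← hlin, sub_zero]
      simp only [this]
      simpa using (hlim G.normal).sub (hlim 0)
    have hoff := hnormal.inner (𝕜 := ℝ) (hlim (G.offset • G.normal))
    rw [inner_smul_right, hGG, mul_one] at hoff
    constructor
    · refine hnormal.congr fun n => ?_
      exact (congrArg normal (hK n)).symm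
    · refine hoff.congr fun n => ?_
      exact (congrArg offset (hK n)).symm

end ClosedHalfSpace

open Classical in
/-- The polarization `u^H` of `u` with respect to the closed half-space `H`. -/
noncomputable def polarize {N : ℕ} (H : ClosedHalfSpace N) (u : EuclideanSpace ℝ (Fin N) → ℝ)
    (x : EuclideanSpace ℝ (Fin N)) : ℝ :=
  if x ∈ H.carrier then max (u x) (u (H.reflect x)) else min (u x) (u (H.reflect x))

/-- The iterated polarization `u^{H_1 H_2 ⋯ H_n}`, first with respect to `H_1`, then `H_2`, and
so on up to `H_n`. Here `H k` is the half-space `H_{k+1}`. -/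
noncomputable def polarizeUpTo {N : ℕ} (H : ℕ → ClosedHalfSpace N) :
    ℕ → (EuclideanSpace ℝ (Fin N) → ℝ) → EuclideanSpace ℝ (Fin N) → ℝ
  | 0, u => u
  | n + 1, u => polarize (H n) (polarizeUpTo H n u)

/-- The sequence `u_0 = u`, `u_{n+1} = u_n^{H_1 H_2 ⋯ H_{n+1}}`. Here `H k` is `H_{k+1}`. -/
noncomputable def polarizeSeq {N : ℕ} (H : ℕ → ClosedHalfSpace N)
    (u : EuclideanSpace ℝ (Fin N) → ℝ) : ℕ → EuclideanSpace ℝ (Fin N) → ℝ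
  | 0 => u
  | n + 1 => polarizeUpTo H (n + 1) (polarizeSeq H u n)

/-- `v` is a Schwarz symmetrization of `u`: every superlevel set of `v` of positive level is an
open ball centred at `0` (empty when `R = 0`), of the same measure as that of `u`. -/
def IsSchwarzSymmetrization {N : ℕ} (u v : EuclideanSpace ℝ (Fin N) → ℝ≥0∞) : Prop :=
  ∀ t : ℝ≥0∞, 0 < t → t < ∞ →
    (∃ R : ℝ, 0 ≤ R ∧ {x | t < v x} = Metric.ball 0 R) ∧
      volume {x | t < v x} = volume {x | t < u x}

/-- The Schwarz symmetrization `u^*`. For `N ≥ 1`, and when the superlevel sets of `u` of positive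
level have finite measure, it is the unique Schwarz symmetrization of `u`
(`isSchwarzSymmetrization_iff`). -/
noncomputable def schwarz {N : ℕ} (u : EuclideanSpace ℝ (Fin N) → ℝ≥0∞)
    (x : EuclideanSpace ℝ (Fin N)) : ℝ≥0∞ :=
  sSup {t : ℝ≥0∞ | volume (Metric.ball (0 : EuclideanSpace ℝ (Fin N)) ‖x‖) < volume {y | t < u y}}

theorem lt_schwarz_iff {N : ℕ} (u : EuclideanSpace ℝ (Fin N) → ℝ≥0∞)
    (x : EuclideanSpace ℝ (Fin N)) (t : ℝ≥0∞) :
    t < schwarz u x ↔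
      volume (Metric.ball (0 : EuclideanSpace ℝ (Fin N)) ‖x‖) < volume {y | t < u y} := by
  rw [schwarz, lt_sSup_iff]
  constructor
  · rintro ⟨s, hs, hts⟩
    exact lt_of_lt_of_le hs (measure_mono fun y hy => lt_trans hts hy)
  · intro h
    have ht : t < ∞ := by
      by_contra hcon
      have : t = ∞ := by simpa using hcon
      simp [this] at h
    obtain ⟨s, hanti, hs, hlim⟩ := exists_seq_strictAnti_tendsto' ht
    have hU : {y | t < u y} = ⋃ n, {y | s n < u y} := by
      ext y
      simp only [Set.mem_ofPred_eq, Set.mem_iUnion]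
      constructor
      · intro hy
        exact (hlim.eventually_lt_const hy).exists
      · rintro ⟨n, hn⟩
        exact lt_trans (hs n).1 hn
    have hm : Monotone fun n => {y | s n < u y} := fun m n hmn y hy =>
      lt_of_le_of_lt (hanti.antitone hmn) hy
    rw [hU, hm.measure_iUnion, lt_iSup_iff] at h
    obtain ⟨n, hn⟩ := h
    exact ⟨s n, hn, (hs n).1⟩

theorem isSchwarzSymmetrization_iff {N : ℕ} (hN : 1 ≤ N) {u : EuclideanSpace ℝ (Fin N) → ℝ≥0∞}
    (hu : ∀ t : ℝ≥0∞, 0 < t → volume {x | t < u x} < ∞)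
    (v : EuclideanSpace ℝ (Fin N) → ℝ≥0∞) :
    IsSchwarzSymmetrization u v ↔ v = schwarz u := by
  have hNe : N ≠ 0 := by omega
  have : NeZero N := ⟨hNe⟩
  have : Nonempty (Fin N) := ⟨0⟩
  set c := volume (Metric.ball (0 : EuclideanSpace ℝ (Fin N)) 1) with hc
  have hc0 : c ≠ 0 := (Metric.measure_ball_pos volume _ one_pos).ne'
  have hct : c ≠ ∞ := measure_ball_lt_top.ne
  have hball : ∀ R : ℝ, 0 ≤ R →
      volume (Metric.ball (0 : EuclideanSpace ℝ (Fin N)) R) = ENNReal.ofReal (R ^ N) * c := by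
    intro R hR
    rw [Measure.addHaar_ball _ _ hR, finrank_euclideanSpace_fin]
  have hlt : ∀ r R : ℝ, 0 ≤ r → 0 ≤ R →
      (volume (Metric.ball (0 : EuclideanSpace ℝ (Fin N)) r) <
        volume (Metric.ball (0 : EuclideanSpace ℝ (Fin N)) R) ↔ r < R) := by
    intro r R hr hR
    rw [hball r hr, hball R hR, ENNReal.mul_lt_mul_iff_left hc0 hct,
      ENNReal.ofReal_lt_ofReal_iff_of_nonneg (by positivity), pow_lt_pow_iff_left₀ hr hR hNe]
  have hex : ∀ m : ℝ≥0∞, m < ∞ → ∃ R : ℝ, 0 ≤ R ∧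
      volume (Metric.ball (0 : EuclideanSpace ℝ (Fin N)) R) = m := by
    intro m hm
    refine ⟨((m / c).toReal) ^ ((N : ℝ)⁻¹), by positivity, ?_⟩
    have hq : m / c ≠ ∞ := ENNReal.div_ne_top hm.ne hc0
    rw [hball _ (by positivity), Real.rpow_inv_natCast_pow ENNReal.toReal_nonneg hNe,
      ENNReal.ofReal_toReal hq, ENNReal.div_mul_cancel hc0 hct]
  constructor
  · intro h
    have hiff : ∀ t : ℝ≥0∞, 0 < t → t < ∞ → ∀ x, t < v x ↔ t < schwarz u x := by
      intro t h0 ht x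
      obtain ⟨⟨R, hR, hE⟩, hm⟩ := h t h0 ht
      rw [lt_schwarz_iff, ← hm, hE, hlt _ _ (norm_nonneg x) hR]
      rw [← mem_ball_zero_iff, ← hE, Set.mem_ofPred_eq]
    funext x
    apply le_antisymm
    · by_contra! hcon
      obtain ⟨t, h1, h2⟩ := exists_between hcon
      exact lt_asymm h1 ((hiff t (lt_of_le_of_lt bot_le h1) (lt_of_lt_of_le h2 le_top) x).1 h2)
    · by_contra! hcon
      obtain ⟨t, h1, h2⟩ := exists_between hcon
      exact lt_asymm h1 ((hiff t (lt_of_le_of_lt bot_le h1) (lt_of_lt_of_le h2 le_top) x).2 h2)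
  · rintro rfl t h0 ht
    obtain ⟨R, hR, hRm⟩ := hex _ (hu t h0)
    have hE : {x | t < schwarz u x} = Metric.ball 0 R := by
      ext x
      rw [Set.mem_ofPred_eq, lt_schwarz_iff, ← hRm, hlt _ _ (norm_nonneg x) hR,
        mem_ball_zero_iff]
    exact ⟨⟨R, hR, hE⟩, by rw [hE, hRm]⟩

/-! Polarization permutes the two values of a function on each pair `{x, σ_H x}`. Hence it preserves
the measures of superlevel sets, and it is nonexpansive in `L^p`, by a two-point convexity
inequality (`eLpNorm_polarize_sub_le`). Schwarz symmetrization is also continuous on the nonnegative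
functions of `L^p` (`tendsto_eLpNorm_schwarzReal_sub`). A three-term estimate therefore reduces the
theorem to a continuous, compactly supported `g ≥ 0`.

For such `g`, all iterates share a bound, a supporting ball and a modulus of continuity. Along any
ultrafilter finer than `atTop` they converge pointwise, hence uniformly, to a function `v` with the
same superlevel measures as `g`. The second moment `∫ f(x) ‖x‖²` serves as a Lyapunov function: when
`0` is interior to `H`, polarization moves larger values closer to `0`, so the moment never
increases, and it is unchanged only if `f^H = f`. Every round starts again from `H_1`, so for fixed
`m` the moment after `m` steps of a late round lies between those of two consecutive `u_n`. In the
limit all polarizations of `v` by `H_1, …, H_m` have the same moment, so each `H_m` fixes `v`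
(`polarize_eq_self_of_tendsto_polarizeSeq`). Density and continuity then make `v` radially
nonincreasing (`le_of_norm_lt_of_polarize_eq_self`), so `v = g^*`. The limit does not depend on the
ultrafilter, so the whole sequence converges. -/

/-! ### Reflections in the boundary hyperplane -/

namespace ClosedHalfSpace

variable {N : ℕ} (H : ClosedHalfSpace N)

theorem inner_normal_self : inner ℝ H.normal H.normal = (1 : ℝ) := by
  rw [real_inner_self_eq_norm_sq, H.norm_normal]; norm_num

theorem mem_carrier {x : EuclideanSpace ℝ (Fin N)} :
    x ∈ H.carrier ↔ inner ℝ H.normal x - H.offset ≤ 0 := by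
  rw [sub_nonpos]; rfl

theorem inner_reflect_sub (x : EuclideanSpace ℝ (Fin N)) :
    inner ℝ H.normal (H.reflect x) - H.offset = -(inner ℝ H.normal x - H.offset) := by
  rw [reflect, inner_sub_right, inner_smul_right, inner_normal_self]; ring

theorem reflect_reflect (x : EuclideanSpace ℝ (Fin N)) : H.reflect (H.reflect x) = x := by
  rw [reflect, inner_reflect_sub, reflect]
  module

theorem reflect_eq_self {x : EuclideanSpace ℝ (Fin N)}
    (hx : inner ℝ H.normal x - H.offset = 0) : H.reflect x = x := by
  rw [reflect, hx]; simp

theorem norm_sub_smul_normal_sq (x : EuclideanSpace ℝ (Fin N)) (c : ℝ) :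
    ‖x - c • H.normal‖ ^ 2 = ‖x‖ ^ 2 - 2 * c * inner ℝ H.normal x + c ^ 2 := by
  rw [norm_sub_sq_real, norm_smul, H.norm_normal, inner_smul_right, real_inner_comm, mul_one,
    Real.norm_eq_abs, sq_abs]
  ring

theorem norm_reflect_sq (x : EuclideanSpace ℝ (Fin N)) :
    ‖H.reflect x‖ ^ 2 = ‖x‖ ^ 2 - 4 * (inner ℝ H.normal x - H.offset) * H.offset := by
  rw [reflect, norm_sub_smul_normal_sq]; ring

theorem dist_reflect (x y : EuclideanSpace ℝ (Fin N)) :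
    dist (H.reflect x) (H.reflect y) = dist x y := by
  have h : H.reflect x - H.reflect y = (x - y) - (2 * inner ℝ H.normal (x - y)) • H.normal := by
    simp only [reflect, inner_sub_right]
    module
  rw [dist_eq_norm, dist_eq_norm, h, ← sq_eq_sq₀ (norm_nonneg _) (norm_nonneg _),
    norm_sub_smul_normal_sq]
  ring

/-- The difference of the squared distances is `4 (⟪ν, x⟫ - b)(⟪ν, y⟫ - b)`, and the two factors
have opposite signs. -/
theorem dist_reflect_right_le {x y : EuclideanSpace ℝ (Fin N)} (hx : x ∈ H.carrier)
    (hy : y ∉ H.carrier) : dist x (H.reflect y) ≤ dist x y := by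
  rw [mem_carrier] at hx hy
  have h : x - H.reflect y =
      (x - y) - (-(2 * (inner ℝ H.normal y - H.offset))) • H.normal := by
    simp only [reflect]
    module
  rw [dist_eq_norm, dist_eq_norm, h, ← sq_le_sq₀ (norm_nonneg _) (norm_nonneg _),
    norm_sub_smul_normal_sq, inner_sub_right]
  nlinarith

theorem continuous_reflect : Continuous H.reflect := by
  unfold reflect
  fun_prop

theorem isClosed_carrier : IsClosed H.carrier :=
  isClosed_le (by fun_prop) (by fun_prop)

theorem offset_pos_of_mem_interior
    (h : (0 : EuclideanSpace ℝ (Fin N)) ∈ interior H.carrier) : 0 < H.offset := by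
  rw [mem_interior_iff_mem_nhds] at h
  have hc : Tendsto (fun t : ℝ => t • H.normal) (𝓝 0) (𝓝 (0 : EuclideanSpace ℝ (Fin N))) := by
    have : Continuous fun t : ℝ => t • H.normal := by fun_prop
    simpa using this.tendsto 0
  have h2 : ∀ᶠ t : ℝ in 𝓝[>] 0, t • H.normal ∈ H.carrier :=
    (hc.eventually h).filter_mono nhdsWithin_le_nhds
  obtain ⟨t, ht, ht0⟩ := (h2.and self_mem_nhdsWithin).exists
  rw [mem_carrier, inner_smul_right, inner_normal_self] at ht
  have : (0 : ℝ) < t := ht0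
  linarith

/-- The reflection with respect to the boundary, as a measurable equivalence. -/
noncomputable def reflectEquiv : EuclideanSpace ℝ (Fin N) ≃ᵐ EuclideanSpace ℝ (Fin N) where
  toFun := H.reflect
  invFun := H.reflect
  left_inv := H.reflect_reflect
  right_inv := H.reflect_reflect
  measurable_toFun := H.continuous_reflect.measurable
  measurable_invFun := H.continuous_reflect.measurable

theorem measurePreserving_reflect : MeasurePreserving H.reflect := by
  have h1 := (ℝ ∙ H.normal)ᗮ.reflection.measurePreserving
  have h2 := measurePreserving_add_right (volume : Measure (EuclideanSpace ℝ (Fin N)))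
    ((2 * H.offset) • H.normal)
  have e : H.reflect = (fun x => x + (2 * H.offset) • H.normal) ∘ (ℝ ∙ H.normal)ᗮ.reflection := by
    funext x
    rw [Function.comp_apply, Submodule.reflection_orthogonal_apply,
    Submodule.reflection_singleton_apply, H.norm_normal, reflect]
    simp only [RCLike.ofReal_real_eq_id, id_eq, one_pow, div_one]
    module
  rw [e]
  exact h2.comp h1

theorem lintegral_comp_reflect (F : EuclideanSpace ℝ (Fin N) → ℝ≥0∞) :
    ∫⁻ x, F (H.reflect x) = ∫⁻ x, F x :=
  H.measurePreserving_reflect.lintegral_comp_emb H.reflectEquiv.measurableEmbedding F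

theorem lintegral_add_comp_reflect {F : EuclideanSpace ℝ (Fin N) → ℝ≥0∞} (hF : AEMeasurable F) :
    ∫⁻ x, (F x + F (H.reflect x)) = 2 * ∫⁻ x, F x := by
  rw [lintegral_add_left' hF, lintegral_comp_reflect, two_mul]

/-- Reflection preserves volume, so an integral is half the integral of its symmetrization. Integral
estimates for polarizations thus reduce to inequalities on the pairs `{x, σ_H x}`. -/
theorem lintegral_le_of_add_reflect_le {F G : EuclideanSpace ℝ (Fin N) → ℝ≥0∞}
    (hF : AEMeasurable F) (hG : AEMeasurable G)
    (h : ∀ x, F x + F (H.reflect x) ≤ G x + G (H.reflect x)) : ∫⁻ x, F x ≤ ∫⁻ x, G x := by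
  have := lintegral_mono (μ := volume) h
  rw [H.lintegral_add_comp_reflect hF, H.lintegral_add_comp_reflect hG] at this
  exact (ENNReal.mul_le_mul_iff_right (by norm_num) (by norm_num)).1 this

end ClosedHalfSpace

/-! ### Polarization: equimeasurability and contraction in `L^p` -/

section Polarize

variable {N : ℕ} (H : ClosedHalfSpace N)

theorem polarize_pair (u : EuclideanSpace ℝ (Fin N) → ℝ) (x : EuclideanSpace ℝ (Fin N)) :
    (x ∈ H.carrier ∧ polarize H u x = max (u x) (u (H.reflect x)) ∧
        polarize H u (H.reflect x) = min (u x) (u (H.reflect x))) ∨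
      (x ∉ H.carrier ∧ polarize H u x = min (u x) (u (H.reflect x)) ∧
        polarize H u (H.reflect x) = max (u x) (u (H.reflect x))) := by
  by_cases hx : x ∈ H.carrier
  · refine Or.inl ⟨hx, by rw [polarize, if_pos hx], ?_⟩
    by_cases hr : H.reflect x ∈ H.carrier
    -- Both points lie in `H` only on the boundary, where they coincide and the max and min agree.
    · have h1 := H.mem_carrier.1 hx
      have h2 := H.mem_carrier.1 hr
      rw [H.inner_reflect_sub] at h2
      have h3 := H.reflect_eq_self (x := x) (by linarith)
      rw [polarize, if_pos hr, H.reflect_reflect, h3, max_self, min_self]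
    · rw [polarize, if_neg hr, H.reflect_reflect, min_comm]
  · refine Or.inr ⟨hx, by rw [polarize, if_neg hx], ?_⟩
    have hr : H.reflect x ∈ H.carrier := by
      rw [H.mem_carrier] at hx ⊢
      rw [H.inner_reflect_sub]
      linarith
    rw [polarize, if_pos hr, H.reflect_reflect, max_comm]

theorem polarize_add_reflect {M : Type*} [AddCommMagma M] (F : ℝ → M)
    (u : EuclideanSpace ℝ (Fin N) → ℝ) (x : EuclideanSpace ℝ (Fin N)) :
    F (polarize H u x) + F (polarize H u (H.reflect x)) = F (u x) + F (u (H.reflect x)) := by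
  rcases polarize_pair H u x with ⟨-, h1, h2⟩ | ⟨-, h1, h2⟩ <;> rw [h1, h2] <;>
    rcases le_total (u x) (u (H.reflect x)) with h | h <;>
    simp [h, add_comm]

theorem MeasureTheory.AEStronglyMeasurable.polarize {u : EuclideanSpace ℝ (Fin N) → ℝ}
    (hu : AEStronglyMeasurable u) : AEStronglyMeasurable (polarize H u) := by
  classical
  have hr : AEStronglyMeasurable (fun x => u (H.reflect x)) :=
    hu.comp_measurePreserving H.measurePreserving_reflect
  have : _root_.polarize H u = H.carrier.piecewise (fun x => max (u x) (u (H.reflect x)))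
      (fun x => min (u x) (u (H.reflect x))) := by
    funext x
    simp only [_root_.polarize, Set.piecewise]
  rw [this]
  exact AEStronglyMeasurable.piecewise H.isClosed_carrier.measurableSet
    (hu.sup hr).restrict (hu.inf hr).restrict

theorem lintegral_comp_polarize {F : ℝ → ℝ≥0∞} (hF : Measurable F)
    {u : EuclideanSpace ℝ (Fin N) → ℝ} (hu : AEStronglyMeasurable u) :
    ∫⁻ x, F (polarize H u x) = ∫⁻ x, F (u x) := by
  have h1 := hF.comp_aemeasurable hu.aemeasurable
  have h2 := hF.comp_aemeasurable (hu.polarize H).aemeasurable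
  exact le_antisymm
    (H.lintegral_le_of_add_reflect_le h2 h1 fun x => (polarize_add_reflect H F u x).le)
    (H.lintegral_le_of_add_reflect_le h1 h2 fun x => (polarize_add_reflect H F u x).ge)

theorem volume_lt_polarize {u : EuclideanSpace ℝ (Fin N) → ℝ} (hu : AEStronglyMeasurable u)
    (t : ℝ) : volume {x | t < polarize H u x} = volume {x | t < u x} := by
  have key : ∀ {v : EuclideanSpace ℝ (Fin N) → ℝ}, AEStronglyMeasurable v →
      ∫⁻ x, (Set.Ioi t).indicator 1 (v x) = volume {x | t < v x} := by
    intro v hv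
    have : NullMeasurableSet {x | t < v x} :=
      nullMeasurableSet_lt aemeasurable_const hv.aemeasurable
    rw [← lintegral_indicator_one₀ this]
    rfl
  rw [← key hu, ← key (hu.polarize H)]
  exact lintegral_comp_polarize H (measurable_one.indicator measurableSet_Ioi) hu

/-- If `s` is the convex combination of `S` and `T` with weights `l, 1 - l`, then `t` is the one
with the weights exchanged; add the two convexity inequalities. -/
theorem ConvexOn.add_le_add_of_mem_Icc {φ : ℝ → ℝ} (hφ : ConvexOn ℝ Set.univ φ) {s t S T : ℝ}
    (hsum : s + t = S + T) (h1 : T ≤ s) (h2 : s ≤ S) : φ s + φ t ≤ φ S + φ T := by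
  rcases (h1.trans h2).eq_or_lt with h | h
  · have : s = S := by linarith
    have : t = T := by linarith
    subst_vars
    rfl
  · set l := (s - T) / (S - T)
    have hl : l * (S - T) = s - T := div_mul_cancel₀ _ (by linarith)
    have l0 : 0 ≤ l := div_nonneg (by linarith) (by linarith)
    have l1 : l ≤ 1 := (div_le_one (by linarith)).2 (by linarith)
    have e1 := hφ.2 (Set.mem_univ S) (Set.mem_univ T) l0 (sub_nonneg.2 l1) (by ring)
    have e2 := hφ.2 (Set.mem_univ S) (Set.mem_univ T) (sub_nonneg.2 l1) l0 (by ring)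
    simp only [smul_eq_mul] at e1 e2
    rw [show l * S + (1 - l) * T = s by linarith] at e1
    rw [show (1 - l) * S + l * T = t by linarith] at e2
    linarith

/-- If the two pairs are ordered alike, both sides agree. Otherwise sorting keeps the sum of the
differences and places them between the original two. -/
theorem ConvexOn.max_sub_max_add_min_sub_min_le {φ : ℝ → ℝ} (hφ : ConvexOn ℝ Set.univ φ)
    (a b c d : ℝ) :
    φ (max a b - max c d) + φ (min a b - min c d) ≤ φ (a - c) + φ (b - d) := by
  rcases le_total a b with h | h <;> rcases le_total c d with h' | h' <;> simp only [h, h',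
    max_eq_left, max_eq_right, min_eq_left, min_eq_right]
  · rw [add_comm]
  · rw [add_comm (φ (a - c))]
    exact hφ.add_le_add_of_mem_Icc (by ring) (by linarith) (by linarith)
  · exact hφ.add_le_add_of_mem_Icc (by ring) (by linarith) (by linarith)
  · rfl

theorem convexOn_abs_rpow {q : ℝ} (hq : 1 ≤ q) : ConvexOn ℝ Set.univ fun x : ℝ => |x| ^ q := by
  refine ⟨convex_univ, fun x _ y _ a b ha hb hab => ?_⟩
  have h1 : |a • x + b • y| ≤ a • |x| + b • |y| := by
    refine (abs_add_le _ _).trans ?_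
    simp [abs_mul, abs_of_nonneg ha, abs_of_nonneg hb]
  exact (Real.rpow_le_rpow (abs_nonneg _) h1 (by linarith)).trans
    ((convexOn_rpow hq).2 (Set.mem_Ici.2 (abs_nonneg x)) (Set.mem_Ici.2 (abs_nonneg y)) ha hb hab)

theorem eLpNorm_polarize_sub_le {p : ℝ≥0∞} (hp1 : 1 ≤ p) (hp : p ≠ ∞)
    {u v : EuclideanSpace ℝ (Fin N) → ℝ} (hu : AEStronglyMeasurable u)
    (hv : AEStronglyMeasurable v) :
    eLpNorm (fun x => polarize H u x - polarize H v x) p volume ≤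
      eLpNorm (fun x => u x - v x) p volume := by
  have hp0 : p ≠ 0 := (zero_lt_one.trans_le hp1).ne'
  have hq : 1 ≤ p.toReal := by
    rw [← ENNReal.toReal_one]
    exact ENNReal.toReal_mono hp hp1
  rw [eLpNorm_eq_lintegral_rpow_enorm_toReal hp0 hp, eLpNorm_eq_lintegral_rpow_enorm_toReal hp0 hp]
  refine ENNReal.rpow_le_rpow ?_ (by positivity)
  refine H.lintegral_le_of_add_reflect_le
    (((hu.polarize H).sub (hv.polarize H)).enorm.pow_const _) ((hu.sub hv).enorm.pow_const _) ?_
  intro x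
  have conv : ∀ y : ℝ, ‖y‖ₑ ^ p.toReal = ENNReal.ofReal (|y| ^ p.toReal) := by
    intro y
    rw [Real.enorm_eq_ofReal_abs, ENNReal.ofReal_rpow_of_nonneg (abs_nonneg _) (by linarith)]
  simp only [conv]
  have pos : ∀ y : ℝ, 0 ≤ |y| ^ p.toReal := fun y => by positivity
  rw [← ENNReal.ofReal_add (pos _) (pos _), ← ENNReal.ofReal_add (pos _) (pos _)]
  refine ENNReal.ofReal_le_ofReal ?_
  have key := (convexOn_abs_rpow hq).max_sub_max_add_min_sub_min_le (u x) (u (H.reflect x)) (v x)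
    (v (H.reflect x))
  -- Whether max or min is taken depends only on the side of `x`, so `u` and `v` are sorted in the
  -- same direction.
  rcases polarize_pair H u x with ⟨hx, h1, h2⟩ | ⟨hx, h1, h2⟩ <;>
    rcases polarize_pair H v x with ⟨hx', h3, h4⟩ | ⟨hx', h3, h4⟩
  · rw [h1, h2, h3, h4]; exact key
  · exact absurd hx hx'
  · exact absurd hx' hx
  · rw [h1, h2, h3, h4, add_comm]; exact key

end Polarize

/-! ### Iterated polarizations -/

section Sequence

variable {N : ℕ} (H : ℕ → ClosedHalfSpace N)

/-- A property of functions that polarizations preserve is inherited by the iterates. -/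
theorem polarizeUpTo_induction {P : (EuclideanSpace ℝ (Fin N) → ℝ) → Prop}
    (hP : ∀ n u, P u → P (polarize (H n) u)) {u : EuclideanSpace ℝ (Fin N) → ℝ} (hu : P u)
    (n : ℕ) : P (polarizeUpTo H n u) := by
  induction n with
  | zero => exact hu
  | succ n ih => exact hP n _ ih

theorem polarizeSeq_induction {P : (EuclideanSpace ℝ (Fin N) → ℝ) → Prop}
    (hP : ∀ n u, P u → P (polarize (H n) u)) {u : EuclideanSpace ℝ (Fin N) → ℝ} (hu : P u)
    (n : ℕ) : P (polarizeSeq H u n) := by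
  induction n with
  | zero => exact hu
  | succ n ih => exact polarizeUpTo_induction H hP ih (n + 1)

theorem MeasureTheory.AEStronglyMeasurable.polarizeUpTo {u : EuclideanSpace ℝ (Fin N) → ℝ}
    (hu : AEStronglyMeasurable u) (n : ℕ) : AEStronglyMeasurable (polarizeUpTo H n u) :=
  polarizeUpTo_induction H (P := fun u => AEStronglyMeasurable u)
    (fun _ _ h => h.polarize _) hu n

theorem MeasureTheory.AEStronglyMeasurable.polarizeSeq {u : EuclideanSpace ℝ (Fin N) → ℝ}
    (hu : AEStronglyMeasurable u) (n : ℕ) : AEStronglyMeasurable (polarizeSeq H u n) :=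
  polarizeSeq_induction H (P := fun u => AEStronglyMeasurable u)
    (fun _ _ h => h.polarize _) hu n

theorem eLpNorm_polarizeUpTo_sub_le {p : ℝ≥0∞} (hp1 : 1 ≤ p) (hp : p ≠ ∞)
    {u v : EuclideanSpace ℝ (Fin N) → ℝ} (hu : AEStronglyMeasurable u)
    (hv : AEStronglyMeasurable v) (n : ℕ) :
    eLpNorm (fun x => polarizeUpTo H n u x - polarizeUpTo H n v x) p volume ≤
      eLpNorm (fun x => u x - v x) p volume := by
  induction n with
  | zero => exact le_rfl
  | succ n ih =>
    exact (eLpNorm_polarize_sub_le (H n) hp1 hp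
      (hu.polarizeUpTo H n)
      (hv.polarizeUpTo H n)).trans ih

theorem eLpNorm_polarizeSeq_sub_le {p : ℝ≥0∞} (hp1 : 1 ≤ p) (hp : p ≠ ∞)
    {u v : EuclideanSpace ℝ (Fin N) → ℝ} (hu : AEStronglyMeasurable u)
    (hv : AEStronglyMeasurable v) (n : ℕ) :
    eLpNorm (fun x => polarizeSeq H u n x - polarizeSeq H v n x) p volume ≤
      eLpNorm (fun x => u x - v x) p volume := by
  induction n with
  | zero => exact le_rfl
  | succ n ih =>
    exact (eLpNorm_polarizeUpTo_sub_le H hp1 hp (hu.polarizeSeq H n) (hv.polarizeSeq H n)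
      (n + 1)).trans ih

theorem polarizeSeq_zero_fun (n : ℕ) :
    polarizeSeq H (fun _ => 0) n = fun _ => 0 :=
  polarizeSeq_induction H (P := fun u => u = fun _ => 0)
    (by rintro n _ rfl; funext x; simp [polarize]) rfl n

theorem MeasureTheory.MemLp.polarizeSeq {p : ℝ≥0∞} (hp1 : 1 ≤ p) (hp : p ≠ ∞)
    {u : EuclideanSpace ℝ (Fin N) → ℝ} (hu : MemLp u p volume) (n : ℕ) :
    MemLp (polarizeSeq H u n) p volume := by
  refine ⟨hu.1.polarizeSeq H n, ?_⟩
  have := eLpNorm_polarizeSeq_sub_le H hp1 hp hu.1 (v := fun _ => 0)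
    aestronglyMeasurable_const n
  simp only [polarizeSeq_zero_fun, sub_zero] at this
  exact this.trans_lt hu.2

end Sequence

/-! ### Equicontinuous families with common support -/

/-- The nonnegative functions bounded by `M`, vanishing outside the ball of radius `R`, with
modulus of uniform continuity `δ`. -/
structure HasBoundsAndModulus {N : ℕ} (R M : ℝ) (δ : ℝ → ℝ)
    (f : EuclideanSpace ℝ (Fin N) → ℝ) : Prop where
  nonneg : ∀ x, 0 ≤ f x
  le_bound : ∀ x, f x ≤ M
  eq_zero : ∀ x, R < ‖x‖ → f x = 0
  modulus_pos : ∀ ε, 0 < ε → 0 < δ ε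
  abs_sub_le : ∀ ε, 0 < ε → ∀ x y, dist x y < δ ε → |f x - f y| ≤ ε

namespace HasBoundsAndModulus

variable {N : ℕ} {R M : ℝ} {δ : ℝ → ℝ} {f : EuclideanSpace ℝ (Fin N) → ℝ}

theorem continuous (hf : HasBoundsAndModulus R M δ f) : Continuous f := by
  refine Metric.continuous_iff.2 fun x ε hε => ?_
  refine ⟨δ (ε / 2), hf.modulus_pos _ (by linarith), fun y hy => ?_⟩
  rw [Real.dist_eq]
  linarith [hf.abs_sub_le (ε / 2) (by linarith) y x hy]

theorem hasCompactSupport (hf : HasBoundsAndModulus R M δ f) : HasCompactSupport f := by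
  refine HasCompactSupport.intro (isCompact_closedBall (0 : EuclideanSpace ℝ (Fin N)) R) ?_
  intro x hx
  rw [mem_closedBall_zero_iff, not_le] at hx
  exact hf.eq_zero x hx

theorem exists_of_hasCompactSupport (hc : Continuous f) (hs : HasCompactSupport f)
    (h0 : ∀ x, 0 ≤ f x) : ∃ R M δ, HasBoundsAndModulus R M δ f := by
  obtain ⟨R, hR⟩ := hs.isCompact.isBounded.subset_closedBall (0 : EuclideanSpace ℝ (Fin N))
  obtain ⟨M, hM⟩ := hc.bddAbove_range_of_hasCompactSupport hs
  have hu := Metric.uniformContinuous_iff.1 (hs.uniformContinuous_of_continuous hc)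
  choose! δ hδ using hu
  refine ⟨R, M, δ, h0, fun x => hM (Set.mem_range_self x), fun x hx => ?_, fun ε hε => (hδ ε hε).1,
    fun ε hε x y hxy => ((hδ ε hε).2 hxy).le⟩
  by_contra hne
  have := hR (subset_tsupport f hne)
  rw [mem_closedBall_zero_iff] at this
  linarith

/-- All three parameters survive unchanged, which gives compactness of the iterates. The support
stays in the ball because `‖σ_H x‖ ≥ ‖x‖` for `x ∈ H` when the offset is positive. -/
theorem polarize (hf : HasBoundsAndModulus R M δ f) {H : ClosedHalfSpace N}
    (hH : 0 < H.offset) : HasBoundsAndModulus R M δ (polarize H f) := by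
  refine ⟨fun x => ?_, fun x => ?_, fun x hx => ?_, hf.modulus_pos, fun ε hε => ?_⟩
  · rcases polarize_pair H f x with ⟨-, h, -⟩ | ⟨-, h, -⟩ <;> rw [h]
    · exact le_max_of_le_left (hf.nonneg x)
    · exact le_min (hf.nonneg _) (hf.nonneg _)
  · rcases polarize_pair H f x with ⟨-, h, -⟩ | ⟨-, h, -⟩ <;> rw [h]
    · exact max_le (hf.le_bound _) (hf.le_bound _)
    · exact min_le_of_left_le (hf.le_bound x)
  · rcases polarize_pair H f x with ⟨hxH, h, -⟩ | ⟨-, h, -⟩ <;> rw [h]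
    · have h1 : R < ‖H.reflect x‖ := by
        refine hx.trans_le ?_
        rw [← sq_le_sq₀ (norm_nonneg _) (norm_nonneg _), H.norm_reflect_sq]
        nlinarith [H.mem_carrier.1 hxH]
      rw [hf.eq_zero x hx, hf.eq_zero _ h1, max_self]
    · rw [hf.eq_zero x hx, min_eq_left (hf.nonneg _)]
  -- Across the boundary the max and min may select any of four pairs of points, but none of these
  -- is farther apart than `x` and `y`.
  · have mixed : ∀ x y, dist x y < δ ε → x ∈ H.carrier → y ∉ H.carrier →
        |_root_.polarize H f x - _root_.polarize H f y| ≤ ε := by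
      intro x y hxy hx hy
      have hr := H.dist_reflect_right_le hx hy
      have h1 := hf.abs_sub_le ε hε x y hxy
      have h2 := hf.abs_sub_le ε hε (H.reflect x) (H.reflect y) (by rwa [H.dist_reflect])
      have h3 := hf.abs_sub_le ε hε x (H.reflect y) (hr.trans_lt hxy)
      have h4 := hf.abs_sub_le ε hε (H.reflect x) y (by
        rw [← H.dist_reflect, H.reflect_reflect]; exact hr.trans_lt hxy)
      rw [_root_.polarize, if_pos hx, _root_.polarize, if_neg hy]
      rcases max_choice (f x) (f (H.reflect x)) with h | h <;>
        rcases min_choice (f y) (f (H.reflect y)) with h' | h' <;> rw [h, h'] <;> assumption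
    intro x y hxy
    by_cases hx : x ∈ H.carrier <;> by_cases hy : y ∈ H.carrier
    · rw [_root_.polarize, if_pos hx, _root_.polarize, if_pos hy]
      exact (abs_max_sub_max_le_max _ _ _ _).trans (max_le (hf.abs_sub_le ε hε x y hxy)
        (hf.abs_sub_le ε hε _ _ (by rwa [H.dist_reflect])))
    · exact mixed x y hxy hx hy
    · rw [abs_sub_comm]
      exact mixed y x (by rwa [dist_comm]) hy hx
    · rw [_root_.polarize, if_neg hx, _root_.polarize, if_neg hy]
      exact (abs_min_sub_min_le_max _ _ _ _).trans (max_le (hf.abs_sub_le ε hε x y hxy)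
        (hf.abs_sub_le ε hε _ _ (by rwa [H.dist_reflect])))

section Limit

variable {ι : Type*} {l : Filter ι} {F : ι → EuclideanSpace ℝ (Fin N) → ℝ}

theorem of_tendsto [l.NeBot] (hF : ∀ i, HasBoundsAndModulus R M δ (F i))
    (hlim : ∀ x, Tendsto (fun i => F i x) l (𝓝 (f x))) : HasBoundsAndModulus R M δ f := by
  obtain ⟨i₀⟩ : Nonempty ι := l.nonempty_of_neBot
  refine ⟨fun x => ge_of_tendsto' (hlim x) fun i => (hF i).nonneg x,
    fun x => le_of_tendsto' (hlim x) fun i => (hF i).le_bound x, fun x hx => ?_,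
    (hF i₀).modulus_pos, fun ε hε x y hxy => ?_⟩
  · refine tendsto_nhds_unique (hlim x) ?_
    simp only [fun i => (hF i).eq_zero x hx]
    exact tendsto_const_nhds
  · exact le_of_tendsto' ((hlim x).sub (hlim y)).abs fun i => (hF i).abs_sub_le ε hε x y hxy

/-- The common modulus makes pointwise convergence uniform: it suffices to control a finite net of
the supporting ball. A general filter is allowed so that ultrafilters can be used. -/
theorem eventually_abs_sub_le [l.NeBot] (hF : ∀ i, HasBoundsAndModulus R M δ (F i))
    (hlim : ∀ x, Tendsto (fun i => F i x) l (𝓝 (f x))) {ε : ℝ} (hε : 0 < ε) :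
    ∀ᶠ i in l, ∀ x, |F i x - f x| ≤ ε := by
  have hf := of_tendsto hF hlim
  have hε3 : 0 < ε / 3 := by linarith
  obtain ⟨t, -, htf, ht⟩ := (isCompact_closedBall (0 : EuclideanSpace ℝ (Fin N)) R).finite_cover_balls
    (hf.modulus_pos _ hε3)
  have h1 : ∀ᶠ i in l, ∀ c ∈ t, |F i c - f c| < ε / 3 :=
    (eventually_all_finite htf).2 fun c _ => by
      simpa only [Real.dist_eq] using Metric.tendsto_nhds.1 (hlim c) (ε / 3) hε3
  filter_upwards [h1] with i hi x
  by_cases hx : x ∈ Metric.closedBall (0 : EuclideanSpace ℝ (Fin N)) R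
  · obtain ⟨c, hc, hxc⟩ := Set.mem_iUnion₂.1 (ht hx)
    have e1 := abs_le.1 ((hF i).abs_sub_le _ hε3 x c hxc)
    have e2 := abs_le.1 (hf.abs_sub_le _ hε3 x c hxc)
    have e3 := abs_lt.1 (hi c hc)
    rw [abs_le]
    constructor <;> linarith
  · rw [mem_closedBall_zero_iff, not_le] at hx
    rw [(hF i).eq_zero x hx, hf.eq_zero x hx]
    simpa using hε.le

end Limit

end HasBoundsAndModulus

/-! ### The second moment as a Lyapunov function -/

section Moment

variable {N : ℕ} {R M : ℝ} {δ : ℝ → ℝ} {f : EuclideanSpace ℝ (Fin N) → ℝ}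

/-- The second moment of a function. -/
noncomputable def secondMoment (f : EuclideanSpace ℝ (Fin N) → ℝ) : ℝ := ∫ x, f x * ‖x‖ ^ 2

theorem secondMoment_nonneg (hf : HasBoundsAndModulus R M δ f) : 0 ≤ secondMoment f :=
  integral_nonneg fun x => mul_nonneg (hf.nonneg x) (by positivity)

theorem HasBoundsAndModulus.integrable_mul_norm_sq (hf : HasBoundsAndModulus R M δ f) :
    Integrable fun x => f x * ‖x‖ ^ 2 :=
  (hf.continuous.mul (by fun_prop)).integrable_of_hasCompactSupport hf.hasCompactSupport.mul_right

theorem tendsto_secondMoment {ι : Type*} {l : Filter ι} [l.NeBot]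
    {F : ι → EuclideanSpace ℝ (Fin N) → ℝ} (hF : ∀ i, HasBoundsAndModulus R M δ (F i))
    (hlim : ∀ x, Tendsto (fun i => F i x) l (𝓝 (f x))) :
    Tendsto (fun i => secondMoment (F i)) l (𝓝 (secondMoment f)) := by
  have hf := HasBoundsAndModulus.of_tendsto hF hlim
  set B := Metric.closedBall (0 : EuclideanSpace ℝ (Fin N)) R
  set C := R ^ 2 * volume.real B
  have hC : 0 ≤ C := by positivity
  refine Metric.tendsto_nhds.2 fun η hη => ?_
  -- `C` may vanish, hence the `+ 1`.
  have hε : 0 < η / (C + 1) := by positivity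
  filter_upwards [HasBoundsAndModulus.eventually_abs_sub_le hF hlim hε] with i hi
  have h1 : secondMoment (F i) - secondMoment f = ∫ x in B, (F i x - f x) * ‖x‖ ^ 2 := by
    rw [secondMoment, secondMoment,
      ← integral_sub (hF i).integrable_mul_norm_sq hf.integrable_mul_norm_sq,
      setIntegral_eq_integral_of_forall_compl_eq_zero]
    · simp only [sub_mul]
    · intro x hx
      rw [mem_closedBall_zero_iff, not_le] at hx
      rw [(hF i).eq_zero x hx, hf.eq_zero x hx]
      simp
  rw [Real.dist_eq, h1]
  have hB : volume B < ∞ := measure_closedBall_lt_top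
  have hbound : ∀ x ∈ B, ‖(F i x - f x) * ‖x‖ ^ 2‖ ≤ η / (C + 1) * R ^ 2 := by
    intro x hx
    rw [mem_closedBall_zero_iff] at hx
    rw [norm_mul, Real.norm_eq_abs, norm_pow, norm_norm]
    gcongr
    exact hi x
  refine (norm_setIntegral_le_of_norm_le_const hB hbound).trans_lt ?_
  rw [mul_assoc, div_mul_eq_mul_div, div_lt_iff₀ (by positivity)]
  change η * C < _
  linarith

/-- The second factor is `4 (⟪ν, x⟫ - b) b`: nonpositive in `H`, where polarization raises `f`, and
positive outside, where it lowers `f`. -/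
theorem polarize_sub_mul_offset_nonpos {H : ClosedHalfSpace N} (hH : 0 < H.offset)
    (f : EuclideanSpace ℝ (Fin N) → ℝ) (x : EuclideanSpace ℝ (Fin N)) :
    (polarize H f x - f x) * (‖x‖ ^ 2 - ‖H.reflect x‖ ^ 2) ≤ 0 := by
  rw [H.norm_reflect_sq, sub_sub_cancel]
  rcases polarize_pair H f x with ⟨hx, h, -⟩ | ⟨hx, h, -⟩ <;> rw [h] <;> rw [H.mem_carrier] at hx
  · exact mul_nonpos_of_nonneg_of_nonpos (sub_nonneg.2 (le_max_left _ _))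
      (mul_nonpos_of_nonpos_of_nonneg (by linarith) hH.le)
  · exact mul_nonpos_of_nonpos_of_nonneg (sub_nonpos.2 (min_le_left _ _))
      (mul_nonneg (by linarith) hH.le)

/-- The change `f^H - f` is odd under the reflection, so symmetrizing the moment integrand produces
an integrand of constant sign. Integrability is recorded for the equality case. -/
theorem two_mul_secondMoment_polarize_sub (hf : HasBoundsAndModulus R M δ f)
    {H : ClosedHalfSpace N} (hH : 0 < H.offset) :
    Integrable (fun x => (polarize H f x - f x) * (‖x‖ ^ 2 - ‖H.reflect x‖ ^ 2)) ∧
    ∫ x, (polarize H f x - f x) * (‖x‖ ^ 2 - ‖H.reflect x‖ ^ 2) =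
      2 * (secondMoment (polarize H f) - secondMoment f) := by
  have hp := hf.polarize hH
  set g := fun x => polarize H f x * ‖x‖ ^ 2 - f x * ‖x‖ ^ 2 with hg
  have hgi : Integrable g := hp.integrable_mul_norm_sq.sub hf.integrable_mul_norm_sq
  have hgr : Integrable fun x => g (H.reflect x) :=
    (H.measurePreserving_reflect.integrable_comp_emb H.reflectEquiv.measurableEmbedding).2 hgi
  have e : (fun x => (polarize H f x - f x) * (‖x‖ ^ 2 - ‖H.reflect x‖ ^ 2)) =
      fun x => g x + g (H.reflect x) := by
    funext x
    have := polarize_add_reflect H id f x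
    simp only [id] at this
    simp only [hg]
    linear_combination (-‖H.reflect x‖ ^ 2) * this
  rw [e]
  refine ⟨hgi.add hgr, ?_⟩
  rw [integral_add hgi hgr,
    H.measurePreserving_reflect.integral_comp H.reflectEquiv.measurableEmbedding g,
    integral_sub hp.integrable_mul_norm_sq hf.integrable_mul_norm_sq, secondMoment, secondMoment]
  ring

theorem secondMoment_polarize_le (hf : HasBoundsAndModulus R M δ f)
    {H : ClosedHalfSpace N} (hH : 0 < H.offset) :
    secondMoment (polarize H f) ≤ secondMoment f := by
  have := (two_mul_secondMoment_polarize_sub hf hH).2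
  have h2 := integral_nonpos (μ := volume) (polarize_sub_mul_offset_nonpos hH f)
  linarith

/-- A continuous integrand of constant sign with zero integral vanishes everywhere. Off the
hyperplane its second factor is nonzero because the offset is positive; on the hyperplane `σ_H x =
x`. -/
theorem polarize_eq_self_of_secondMoment_eq (hf : HasBoundsAndModulus R M δ f)
    {H : ClosedHalfSpace N} (hH : 0 < H.offset)
    (h : secondMoment (polarize H f) = secondMoment f) : polarize H f = f := by
  obtain ⟨hi, he⟩ := two_mul_secondMoment_polarize_sub hf hH
  rw [h, sub_self, mul_zero] at he
  have h0 : (fun x => -((polarize H f x - f x) * (‖x‖ ^ 2 - ‖H.reflect x‖ ^ 2))) =ᵐ[volume]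
      fun _ => (0 : ℝ) := by
    refine (integral_eq_zero_iff_of_nonneg (fun x => ?_) hi.neg).1 ?_
    · exact neg_nonneg.2 (polarize_sub_mul_offset_nonpos hH f x)
    · exact (integral_neg _).trans (by rw [he, neg_zero])
  have hc : Continuous fun x => -((polarize H f x - f x) * (‖x‖ ^ 2 - ‖H.reflect x‖ ^ 2)) := by
    have h1 := (hf.polarize hH).continuous
    have h2 := hf.continuous
    have h3 := H.continuous_reflect
    fun_prop
  have h0' := (hc.ae_eq_iff_eq volume continuous_const).1 h0
  funext x
  have hx := congrFun h0' x
  simp only [neg_eq_zero, H.norm_reflect_sq, sub_sub_cancel] at hx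
  rcases mul_eq_zero.1 hx with h1 | h1
  · exact sub_eq_zero.1 h1
  · have hs : inner ℝ H.normal x - H.offset = 0 := by
      rcases mul_eq_zero.1 h1 with h2 | h2
      · linarith
      · exact absurd h2 hH.ne'
    rcases polarize_pair H f x with ⟨-, h, -⟩ | ⟨-, h, -⟩ <;> rw [h, H.reflect_eq_self hs] <;> simp

end Moment

/-! ### Limit points are fixed by every polarization, hence radial -/

section LimitPoints

variable {N : ℕ} {R M : ℝ} {δ : ℝ → ℝ} {H : ℕ → ClosedHalfSpace N}

theorem secondMoment_polarizeUpTo_antitone (hH : ∀ n, 0 < (H n).offset)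
    {f : EuclideanSpace ℝ (Fin N) → ℝ} (hf : HasBoundsAndModulus R M δ f) :
    Antitone fun n => secondMoment (polarizeUpTo H n f) :=
  antitone_nat_of_succ_le fun n => secondMoment_polarize_le
    (polarizeUpTo_induction H (fun k _ h => h.polarize (hH k)) hf n) (hH n)

theorem tendsto_polarizeUpTo {ι : Type*} {l : Filter ι} {F : ι → EuclideanSpace ℝ (Fin N) → ℝ}
    {v : EuclideanSpace ℝ (Fin N) → ℝ} (hlim : ∀ x, Tendsto (fun i => F i x) l (𝓝 (v x))) (m : ℕ)
    (x : EuclideanSpace ℝ (Fin N)) :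
    Tendsto (fun i => polarizeUpTo H m (F i) x) l (𝓝 (polarizeUpTo H m v x)) := by
  induction m generalizing x with
  | zero => exact hlim x
  | succ m ih =>
    simp only [polarizeUpTo, polarize]
    split_ifs
    · exact (ih x).max (ih _)
    · exact (ih x).min (ih _)

theorem polarize_eq_self_of_tendsto_polarizeSeq (hH : ∀ n, 0 < (H n).offset)
    {g v : EuclideanSpace ℝ (Fin N) → ℝ} (hg : HasBoundsAndModulus R M δ g)
    {l : Filter ℕ} [l.NeBot] (hl : l ≤ atTop)
    (hlim : ∀ x, Tendsto (fun n => polarizeSeq H g n x) l (𝓝 (v x))) (m : ℕ) :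
    polarize (H m) v = v := by
  have hseq : ∀ n, HasBoundsAndModulus R M δ (polarizeSeq H g n) :=
    polarizeSeq_induction H (fun k _ h => h.polarize (hH k)) hg
  have hup : ∀ m n, HasBoundsAndModulus R M δ (polarizeUpTo H m (polarizeSeq H g n)) :=
    fun m n => polarizeUpTo_induction H (fun k _ h => h.polarize (hH k)) (hseq n) m
  have hv := HasBoundsAndModulus.of_tendsto hseq hlim
  have hanti : Antitone fun n => secondMoment (polarizeSeq H g n) :=
    antitone_nat_of_succ_le fun n =>
      secondMoment_polarizeUpTo_antitone hH (hseq n) (Nat.zero_le (n + 1))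
  have hL := tendsto_atTop_ciInf hanti
    ⟨0, by rintro _ ⟨n, rfl⟩; exact secondMoment_nonneg (hseq n)⟩
  set L := ⨅ n, secondMoment (polarizeSeq H g n)
  have hconst : ∀ m, secondMoment (polarizeUpTo H m v) = L := by
    intro m
    have h1 : Tendsto (fun n => secondMoment (polarizeUpTo H m (polarizeSeq H g n))) atTop
        (𝓝 L) := by
      -- The iterate `n + 1` is the result of `n + 1` steps from iterate `n`, so once `m ≤ n + 1`
      -- the moment after `m` steps lies between two consecutive terms of a sequence tending to `L`.
      refine tendsto_of_tendsto_of_tendsto_of_le_of_le' ((tendsto_add_atTop_iff_nat 1).2 hL) hL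
        ?_ ?_
      · filter_upwards [eventually_ge_atTop m] with n hn
        exact secondMoment_polarizeUpTo_antitone hH (hseq n) (by omega : m ≤ n + 1)
      · exact Eventually.of_forall fun n =>
          secondMoment_polarizeUpTo_antitone hH (hseq n) (Nat.zero_le m)
    exact tendsto_nhds_unique (tendsto_secondMoment (hup m) (tendsto_polarizeUpTo hlim m))
      (h1.mono_left hl)
  have hfix : ∀ m, polarizeUpTo H m v = v := by
    intro m
    induction m with
    | zero => rfl
    | succ m ih =>
      have h1 := polarize_eq_self_of_secondMoment_eq
        (polarizeUpTo_induction H (fun k _ h => h.polarize (hH k)) hv m) (hH m)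
        ((hconst (m + 1)).trans (hconst m).symm)
      exact h1.trans ih
  have := hfix (m + 1)
  rwa [polarizeUpTo, hfix m] at this

theorem le_of_norm_lt_of_polarize_eq_self
    (hdense : ∀ G : ClosedHalfSpace N, (0 : EuclideanSpace ℝ (Fin N)) ∈ G.carrier →
      G ∈ closure (Set.range H))
    {v : EuclideanSpace ℝ (Fin N) → ℝ} (hv : Continuous v) (hfix : ∀ m, polarize (H m) v = v)
    {x y : EuclideanSpace ℝ (Fin N)} (hxy : ‖x‖ < ‖y‖) : v y ≤ v x := by
  have hne : 0 < ‖y - x‖ := norm_pos_iff.2 fun h => by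
    rw [sub_eq_zero.1 h] at hxy
    exact lt_irrefl _ hxy
  -- The boundary of `G` is the perpendicular bisector of `x` and `y`, so `σ_G x = y`, and `‖x‖ <
  -- ‖y‖` puts `0` in `G`.
  let G : ClosedHalfSpace N := ⟨‖y - x‖⁻¹ • (y - x),
    by rw [norm_smul, norm_inv, norm_norm, inv_mul_cancel₀ hne.ne'],
    (‖y‖ ^ 2 - ‖x‖ ^ 2) / (2 * ‖y - x‖)⟩
  have hsq : ‖y - x‖ ^ 2 = ‖y‖ ^ 2 - 2 * inner ℝ y x + ‖x‖ ^ 2 := norm_sub_sq_real y x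
  have hxs : inner ℝ G.normal x - G.offset = -(‖y - x‖ / 2) := by
    simp only [G, inner_smul_left, inner_sub_left, real_inner_self_eq_norm_sq, map_inv₀,
      conj_trivial]
    field_simp
    linarith
  have h0 : (0 : EuclideanSpace ℝ (Fin N)) ∈ G.carrier := by
    rw [G.mem_carrier, inner_zero_right, zero_sub, neg_nonpos]
    refine div_nonneg (sub_nonneg.2 ?_) (by positivity)
    gcongr
  have hr : G.reflect x = y := by
    rw [ClosedHalfSpace.reflect, hxs]
    simp only [G]
    rw [smul_smul, show 2 * -(‖y - x‖ / 2) * ‖y - x‖⁻¹ = -1 by field_simp]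
    simp
  by_contra! hlt
  have hpair : Continuous fun K : ClosedHalfSpace N => (K.normal, K.offset) :=
    continuous_induced_dom
  have hcn : Continuous fun K : ClosedHalfSpace N => K.normal := hpair.fst
  have hco : Continuous fun K : ClosedHalfSpace N => K.offset := hpair.snd
  -- If `v x < v y`, then `G` satisfies two open conditions, so some `H m` does too; polarizing by
  -- it would strictly raise `v` at `x`.
  have hO1 : IsOpen {K : ClosedHalfSpace N | inner ℝ K.normal x - K.offset < 0} :=
    isOpen_lt (by fun_prop) continuous_const
  have hO2 : IsOpen {K : ClosedHalfSpace N | v x < v (K.reflect x)} := by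
    refine isOpen_lt continuous_const (hv.comp ?_)
    simp only [ClosedHalfSpace.reflect]
    fun_prop
  have hGm : G ∈ {K : ClosedHalfSpace N | inner ℝ K.normal x - K.offset < 0} ∩
      {K : ClosedHalfSpace N | v x < v (K.reflect x)} :=
    ⟨by rw [Set.mem_ofPred_eq, hxs]; linarith, by rwa [Set.mem_ofPred_eq, hr]⟩
  obtain ⟨_, ⟨h1, h2⟩, m, rfl⟩ := mem_closure_iff.1 (hdense G h0) _ (hO1.inter hO2) hGm
  have h3 := congrFun (hfix m) x
  rw [polarize, if_pos ((H m).mem_carrier.2 (le_of_lt h1))] at h3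
  exact absurd (h3 ▸ le_max_right _ _) (not_le.2 h2)

end LimitPoints

/-! ### Superlevel sets and identification of the limit -/

section Superlevel

theorem measure_lt_le_of_forall_pos {α : Type*} [MeasurableSpace α] {μ : Measure α} {f : α → ℝ}
    {t : ℝ} {c : ℝ≥0∞} (h : ∀ ε > 0, μ {x | t + ε < f x} ≤ c) : μ {x | t < f x} ≤ c := by
  have hU : {x | t < f x} = ⋃ n : ℕ, {x | t + 1 / ((n : ℝ) + 1) < f x} := by
    ext x
    simp only [Set.mem_ofPred_eq, Set.mem_iUnion]
    constructor
    · intro hx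
      obtain ⟨n, hn⟩ := exists_nat_one_div_lt (sub_pos.2 hx)
      exact ⟨n, by linarith⟩
    · rintro ⟨n, hn⟩
      have : 0 < 1 / ((n : ℝ) + 1) := by positivity
      linarith
  have hm : Monotone fun n : ℕ => {x | t + 1 / ((n : ℝ) + 1) < f x} := by
    intro m n hmn x hx
    simp only [Set.mem_ofPred_eq] at hx ⊢
    have : 1 / ((n : ℝ) + 1) ≤ 1 / ((m : ℝ) + 1) := by gcongr
    linarith
  rw [hU, hm.measure_iUnion]
  exact iSup_le fun n => h _ (by positivity)

/-- Uniform closeness nests superlevel sets up to a shift of `ε` in the level; continuity of measure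
from below removes the shift. -/
theorem measure_lt_eq_of_forall_exists_abs_sub_le {α : Type*} [MeasurableSpace α] {μ : Measure α}
    {g v : α → ℝ}
    (h : ∀ ε > 0, ∃ f : α → ℝ, (∀ x, |f x - v x| ≤ ε) ∧ ∀ t, μ {x | t < f x} = μ {x | t < g x})
    (t : ℝ) : μ {x | t < v x} = μ {x | t < g x} := by
  apply le_antisymm <;> refine measure_lt_le_of_forall_pos fun ε hε => ?_ <;>
    obtain ⟨f, hf, hfg⟩ := h ε hε <;> rw [← hfg] <;> refine measure_mono fun x hx => ?_ <;>
    have := abs_le.1 (hf x) <;> simp only [Set.mem_ofPred_eq] at hx ⊢ <;> linarith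

variable {N : ℕ}

theorem volume_ball_lt_volume_ball (hN : 1 ≤ N) {r R : ℝ} (hr : 0 ≤ r) (hrR : r < R) :
    volume (Metric.ball (0 : EuclideanSpace ℝ (Fin N)) r) <
      volume (Metric.ball (0 : EuclideanSpace ℝ (Fin N)) R) := by
  have : Nonempty (Fin N) := ⟨⟨0, hN⟩⟩
  rw [Measure.addHaar_ball _ _ hr, Measure.addHaar_ball _ _ (hr.trans hrR.le),
    finrank_euclideanSpace_fin, ENNReal.mul_lt_mul_iff_left
      (Metric.measure_ball_pos volume _ one_pos).ne' measure_ball_lt_top.ne,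
    ENNReal.ofReal_lt_ofReal_iff_of_nonneg (by positivity)]
  exact pow_lt_pow_left₀ hrR hr (by omega)

/-- If `v x ≤ s`, then `{v > s}` lies in the closed ball of radius `‖x‖`. If `v x > s`, continuity
and monotonicity put a strictly larger ball inside `{v > s}`. -/
theorem schwarz_eq_of_radially_antitone (hN : 1 ≤ N) {g v : EuclideanSpace ℝ (Fin N) → ℝ}
    (hv : Continuous v) (hanti : ∀ x y, ‖x‖ < ‖y‖ → v y ≤ v x)
    (hmeas : ∀ t, volume {x | t < v x} = volume {x | t < g x}) (x : EuclideanSpace ℝ (Fin N)) :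
    schwarz (fun y => ENNReal.ofReal (g y)) x = ENNReal.ofReal (v x) := by
  have : Nonempty (Fin N) := ⟨⟨0, hN⟩⟩
  refine eq_of_forall_lt_iff fun t => ?_
  rw [lt_schwarz_iff]
  rcases eq_or_ne t ∞ with rfl | ht
  · simp
  obtain ⟨s, hs, rfl⟩ : ∃ s : ℝ, 0 ≤ s ∧ ENNReal.ofReal s = t :=
    ⟨t.toReal, ENNReal.toReal_nonneg, ENNReal.ofReal_toReal ht⟩
  simp only [ENNReal.ofReal_lt_ofReal_iff_of_nonneg hs]
  rw [← hmeas]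
  constructor
  · contrapose!
    intro hx
    rw [← Measure.addHaar_closedBall_eq_addHaar_ball]
    refine measure_mono fun y hy => ?_
    rw [mem_closedBall_zero_iff]
    by_contra! hlt
    have hy' : s < v y := hy
    linarith [hanti x y hlt]
  · intro hx
    -- An outward direction: `x / ‖x‖`, or any unit vector at the origin.
    obtain ⟨e, he, hex⟩ : ∃ e : EuclideanSpace ℝ (Fin N), ‖e‖ = 1 ∧
        ∀ c : ℝ, 0 < c → ‖x‖ < ‖x + c • e‖ := by
      rcases eq_or_ne x 0 with rfl | h0
      · obtain ⟨e, he⟩ := exists_norm_eq (EuclideanSpace ℝ (Fin N)) zero_le_one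
        refine ⟨e, he, fun c hc => ?_⟩
        rw [norm_zero, zero_add, norm_smul, he, mul_one]
        exact norm_pos_iff.2 hc.ne'
      · have hp := norm_pos_iff.2 h0
        refine ⟨‖x‖⁻¹ • x, by rw [norm_smul, norm_inv, norm_norm, inv_mul_cancel₀ hp.ne'],
          fun c hc => ?_⟩
        have h1 : x + c • ‖x‖⁻¹ • x = (1 + c * ‖x‖⁻¹) • x := by module
        rw [h1, norm_smul, Real.norm_of_nonneg (by positivity)]
        have : 0 < c * ‖x‖⁻¹ := by positivity
        nlinarith
    have hlim : Tendsto (fun c : ℝ => v (x + c • e)) (𝓝[>] 0) (𝓝 (v x)) := by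
      have : Continuous fun c : ℝ => v (x + c • e) := by fun_prop
      simpa using (this.tendsto 0).mono_left nhdsWithin_le_nhds
    obtain ⟨c, hc, hc0⟩ := ((hlim.eventually_const_lt hx).and self_mem_nhdsWithin).exists
    refine (volume_ball_lt_volume_ball hN (norm_nonneg x) (hex c hc0)).trans_le
      (measure_mono fun y hy => ?_)
    rw [mem_ball_zero_iff] at hy
    exact hc.trans_le (hanti _ _ hy)

theorem measurable_schwarz (u : EuclideanSpace ℝ (Fin N) → ℝ≥0∞) : Measurable (schwarz u) := by
  refine measurable_of_Ioi fun t => ?_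
  have hm : Measurable fun r : ℝ => volume (Metric.ball (0 : EuclideanSpace ℝ (Fin N)) r) :=
    Monotone.measurable fun r s hrs => measure_mono (Metric.ball_subset_ball hrs)
  have : schwarz u ⁻¹' Set.Ioi t = {x | volume (Metric.ball (0 : EuclideanSpace ℝ (Fin N)) ‖x‖) <
      volume {y | t < u y}} := by
    ext x
    exact lt_schwarz_iff u x t
  rw [this]
  exact measurableSet_lt (hm.comp measurable_norm) measurable_const

end Superlevel

/-! ### Convergence for continuous functions of compact support -/

/-- The real-valued Schwarz symmetrization of a real-valued function. -/
noncomputable def schwarzReal {N : ℕ} (u : EuclideanSpace ℝ (Fin N) → ℝ)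
    (x : EuclideanSpace ℝ (Fin N)) : ℝ :=
  (schwarz (fun y => ENNReal.ofReal (u y)) x).toReal

section CompactSupport

variable {N : ℕ} {R M : ℝ} {δ : ℝ → ℝ} {H : ℕ → ClosedHalfSpace N}

theorem tendsto_polarizeSeq_schwarzReal (hN : 1 ≤ N) (hH : ∀ n, 0 < (H n).offset)
    (hdense : ∀ G : ClosedHalfSpace N, (0 : EuclideanSpace ℝ (Fin N)) ∈ G.carrier →
      G ∈ closure (Set.range H))
    {g : EuclideanSpace ℝ (Fin N) → ℝ} (hg : HasBoundsAndModulus R M δ g)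
    (x : EuclideanSpace ℝ (Fin N)) :
    Tendsto (fun n => polarizeSeq H g n x) atTop (𝓝 (schwarzReal g x)) := by
  have hseq : ∀ n, HasBoundsAndModulus R M δ (polarizeSeq H g n) :=
    polarizeSeq_induction H (fun k _ h => h.polarize (hH k)) hg
  -- Compactness of `[0, M]` gives limits at all points at once along an ultrafilter, so no diagonal
  -- subsequence is needed.
  refine (Filter.tendsto_iff_ultrafilter _ _ _).2 fun U hU => ?_
  have hex : ∀ y, ∃ a, Tendsto (fun n => polarizeSeq H g n y) U (𝓝 a) := by
    intro y
    obtain ⟨a, -, ha⟩ := (isCompact_Icc (a := (0 : ℝ)) (b := M)).ultrafilter_le_nhds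
      (U.map fun n => polarizeSeq H g n y) (by
        rw [Ultrafilter.coe_map, le_principal_iff, mem_map]
        exact Eventually.of_forall fun n => ⟨(hseq n).nonneg y, (hseq n).le_bound y⟩)
    exact ⟨a, ha⟩
  choose v hlim using hex
  have hv := HasBoundsAndModulus.of_tendsto hseq hlim
  have hfix := polarize_eq_self_of_tendsto_polarizeSeq hH hg hU hlim
  have hmeas := measure_lt_eq_of_forall_exists_abs_sub_le (μ := volume) (g := g) (v := v)
    fun ε hε => by
      obtain ⟨n, hn⟩ := (HasBoundsAndModulus.eventually_abs_sub_le hseq hlim hε).exists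
      refine ⟨polarizeSeq H g n, hn, fun t => ?_⟩
      exact (polarizeSeq_induction H (P := fun f => AEStronglyMeasurable f ∧
        volume {x | t < f x} = volume {x | t < g x})
        (fun k f h => ⟨h.1.polarize _, (volume_lt_polarize (H k) h.1 t).trans h.2⟩)
        ⟨hg.continuous.aestronglyMeasurable, rfl⟩ n).2
  have := schwarz_eq_of_radially_antitone hN hv.continuous
    (fun x y hxy => le_of_norm_lt_of_polarize_eq_self hdense hv.continuous hfix hxy) hmeas x
  rw [schwarzReal, this, ENNReal.toReal_ofReal (hv.nonneg x)]
  exact hlim x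

theorem HasBoundsAndModulus.tendsto_eLpNorm_sub {p : ℝ≥0∞} {ι : Type*} {l : Filter ι} [l.NeBot]
    {F : ι → EuclideanSpace ℝ (Fin N) → ℝ} {f : EuclideanSpace ℝ (Fin N) → ℝ}
    (hF : ∀ i, HasBoundsAndModulus R M δ (F i))
    (hlim : ∀ x, Tendsto (fun i => F i x) l (𝓝 (f x))) :
    Tendsto (fun i => eLpNorm (fun x => F i x - f x) p volume) l (𝓝 0) := by
  have hf := HasBoundsAndModulus.of_tendsto hF hlim
  set B := Metric.closedBall (0 : EuclideanSpace ℝ (Fin N)) R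
  set K := (volume.restrict B) Set.univ ^ p.toReal⁻¹
  have hB : volume B < ∞ := measure_closedBall_lt_top
  have : IsFiniteMeasure (volume.restrict B) := isFiniteMeasure_restrict.2 hB.ne
  have hK : K ≠ ∞ := ENNReal.rpow_ne_top_of_nonneg (by positivity) (measure_ne_top _ _)
  refine ENNReal.tendsto_nhds_zero.2 fun η hη => ?_
  have h0 : Tendsto (fun ε : ℝ => K * ENNReal.ofReal ε) (𝓝[>] 0) (𝓝 0) := by
    have h1 : Tendsto (fun ε : ℝ => ENNReal.ofReal ε) (𝓝[>] 0) (𝓝 0) := by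
      simpa using (ENNReal.continuous_ofReal.tendsto 0).mono_left
        (nhdsWithin_le_nhds (s := Set.Ioi 0))
    simpa using ENNReal.Tendsto.const_mul h1 (Or.inr hK)
  obtain ⟨ε, hε, hε0⟩ := ((ENNReal.tendsto_nhds_zero.1 h0 η hη).and self_mem_nhdsWithin).exists
  filter_upwards [HasBoundsAndModulus.eventually_abs_sub_le hF hlim hε0] with i hi
  rw [← eLpNorm_restrict_eq_of_support_subset (s := B)]
  · exact (eLpNorm_le_of_ae_bound (Eventually.of_forall hi)).trans hε
  · intro x hx
    by_contra hxB
    rw [mem_closedBall_zero_iff, not_le] at hxB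
    exact hx (by simp [(hF i).eq_zero x hxB, hf.eq_zero x hxB])

theorem tendsto_eLpNorm_polarizeSeq_sub_schwarzReal {p : ℝ≥0∞} (hN : 1 ≤ N)
    (hH : ∀ n, 0 < (H n).offset)
    (hdense : ∀ G : ClosedHalfSpace N, (0 : EuclideanSpace ℝ (Fin N)) ∈ G.carrier →
      G ∈ closure (Set.range H))
    {g : EuclideanSpace ℝ (Fin N) → ℝ} (hg : HasBoundsAndModulus R M δ g) :
    Tendsto (fun n => eLpNorm (fun x => polarizeSeq H g n x - schwarzReal g x) p volume)
      atTop (𝓝 0) :=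
  HasBoundsAndModulus.tendsto_eLpNorm_sub
    (polarizeSeq_induction H (fun k _ h => h.polarize (hH k)) hg)
    (tendsto_polarizeSeq_schwarzReal hN hH hdense hg)

end CompactSupport

/-! ### A one-sided Scheffé lemma -/

section Scheffe

/-- Dominated convergence kills the deficit `a - b n`, and convergence of the integrals forces the
excess `b n - a` to follow. Only an asymptotic lower bound on `b n` is required, which is what
superlevel sets provide. -/
theorem tendsto_lintegral_sub_add_sub_of_tendsto_min {α : Type*} [MeasurableSpace α]
    {μ : Measure α} {a : α → ℝ≥0∞} {b : ℕ → α → ℝ≥0∞} (ha : Measurable a)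
    (hb : ∀ n, Measurable (b n)) (hfin : ∫⁻ x, a x ∂μ ≠ ∞)
    (hmin : ∀ᵐ x ∂μ, Tendsto (fun n => min (b n x) (a x)) atTop (𝓝 (a x)))
    (hint : Tendsto (fun n => ∫⁻ x, b n x ∂μ) atTop (𝓝 (∫⁻ x, a x ∂μ))) :
    Tendsto (fun n => ∫⁻ x, ((b n x - a x) + (a x - b n x)) ∂μ) atTop (𝓝 0) := by
  have h1 : Tendsto (fun n => ∫⁻ x, (a x - b n x) ∂μ) atTop (𝓝 0) := by
    have : Tendsto (fun n => ∫⁻ x, (a x - b n x) ∂μ) atTop (𝓝 (∫⁻ _, 0 ∂μ)) := by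
      refine tendsto_lintegral_of_dominated_convergence a (fun n => ha.sub (hb n))
        (fun n => Eventually.of_forall fun x => tsub_le_self) hfin ?_
      filter_upwards [hmin, ae_lt_top ha hfin] with x hx hxa
      have := ENNReal.Tendsto.sub (tendsto_const_nhds (x := a x)) hx (Or.inl hxa.ne)
      simp only [tsub_self, min_comm (b _ x), tsub_min] at this
      exact this
    simpa using this
  have h2 : Tendsto (fun n => ∫⁻ x, (b n x - a x) ∂μ) atTop (𝓝 0) := by
    have e : ∀ n, ∫⁻ x, (b n x - a x) ∂μ =
        (∫⁻ x, b n x ∂μ) + (∫⁻ x, (a x - b n x) ∂μ) - ∫⁻ x, a x ∂μ := by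
      intro n
      refine ENNReal.eq_sub_of_add_eq hfin ?_
      rw [← lintegral_add_right _ ha, ← lintegral_add_left (hb n)]
      refine lintegral_congr fun x => ?_
      rw [tsub_add_eq_max, add_tsub_eq_max]
    simp only [e]
    simpa using ENNReal.Tendsto.sub (hint.add h1) tendsto_const_nhds (Or.inr hfin)
  have e : ∀ n, ∫⁻ x, ((b n x - a x) + (a x - b n x)) ∂μ =
      ∫⁻ x, (b n x - a x) ∂μ + ∫⁻ x, (a x - b n x) ∂μ :=
    fun n => lintegral_add_left ((hb n).sub ha) _
  simp only [e]
  simpa using h2.add h1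

theorem enorm_rpow_eq_ofReal {q : ℝ} (hq : 0 ≤ q) (y : ℝ) :
    ‖y‖ₑ ^ q = ENNReal.ofReal (|y| ^ q) := by
  rw [Real.enorm_eq_ofReal_abs, ENNReal.ofReal_rpow_of_nonneg (abs_nonneg _) hq]

/-- Superadditivity of `s ↦ s ^ q` on `[0, ∞)`; one of the two truncated differences is zero. -/
theorem enorm_sub_rpow_le {q : ℝ} (hq : 1 ≤ q) {x y : ℝ} (hx : 0 ≤ x) (hy : 0 ≤ y) :
    ‖x - y‖ₑ ^ q ≤ (‖x‖ₑ ^ q - ‖y‖ₑ ^ q) + (‖y‖ₑ ^ q - ‖x‖ₑ ^ q) := by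
  have key : ∀ {a b : ℝ}, 0 ≤ b → b ≤ a → ‖a - b‖ₑ ^ q ≤ ‖a‖ₑ ^ q - ‖b‖ₑ ^ q := by
    intro a b hb hab
    simp only [enorm_rpow_eq_ofReal (zero_le_one.trans hq)]
    rw [← ENNReal.ofReal_sub _ (by positivity), abs_of_nonneg (sub_nonneg.2 hab), abs_of_nonneg hb,
      abs_of_nonneg (hb.trans hab)]
    refine ENNReal.ofReal_le_ofReal ?_
    have := Real.add_rpow_le_rpow_add (sub_nonneg.2 hab) hb hq
    rw [sub_add_cancel] at this
    linarith
  rcases le_total y x with h | h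
  · exact (key hy h).trans le_self_add
  · rw [← enorm_neg, neg_sub]
    exact (key hx h).trans le_add_self

theorem tendsto_eLpNorm_of_tendsto_eLpNorm_sub {α : Type*} [MeasurableSpace α] {μ : Measure α}
    {p : ℝ≥0∞} (hp1 : 1 ≤ p) {u : α → ℝ} {g : ℕ → α → ℝ} (hu : MemLp u p μ)
    (hg : ∀ n, AEStronglyMeasurable (g n) μ)
    (hlim : Tendsto (fun n => eLpNorm (g n - u) p μ) atTop (𝓝 0)) :
    Tendsto (fun n => eLpNorm (g n) p μ) atTop (𝓝 (eLpNorm u p μ)) := by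
  have h1 : ∀ n, eLpNorm (g n) p μ ≤ eLpNorm u p μ + eLpNorm (g n - u) p μ := by
    intro n
    have := eLpNorm_add_le hu.1 ((hg n).sub hu.1) hp1
    rwa [add_sub_cancel] at this
  have h2 : ∀ n, eLpNorm u p μ - eLpNorm (g n - u) p μ ≤ eLpNorm (g n) p μ := by
    intro n
    rw [tsub_le_iff_right]
    have := eLpNorm_sub_le (hg n) ((hg n).sub hu.1) hp1
    rwa [sub_sub_cancel] at this
  refine tendsto_of_tendsto_of_tendsto_of_le_of_le (g := fun n => _) (h := fun n => _) ?_ ?_ h2 h1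
  · simpa using ENNReal.Tendsto.sub tendsto_const_nhds hlim (Or.inl hu.2.ne)
  · simpa using tendsto_const_nhds.add hlim

end Scheffe

/-! ### Continuity of Schwarz symmetrization in `L^p` -/

section Schwarz

variable {N : ℕ} {p : ℝ≥0∞} {u : EuclideanSpace ℝ (Fin N) → ℝ}

theorem measurable_schwarzReal (u : EuclideanSpace ℝ (Fin N) → ℝ) : Measurable (schwarzReal u) :=
  (measurable_schwarz _).ennreal_toReal

theorem volume_lt_schwarz (hN : 1 ≤ N) (hp0 : p ≠ 0) (hp : p ≠ ∞) (hu : MemLp u p volume) {t : ℝ≥0∞}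
    (h0 : 0 < t) (ht : t < ∞) :
    volume {x | t < schwarz (fun y => ENNReal.ofReal (u y)) x} =
        volume {x | t < ENNReal.ofReal (u x)} ∧ volume {x | t < ENNReal.ofReal (u x)} < ∞ := by
  have hfin : ∀ t : ℝ≥0∞, 0 < t → volume {x | t < ENNReal.ofReal (u x)} < ∞ := fun t h0 =>
    (measure_mono fun x hx => (le_of_lt hx).trans (Real.ofReal_le_enorm _)).trans_lt
      (hu.meas_ge_lt_top' hp0 hp h0.ne')
  exact ⟨((isSchwarzSymmetrization_iff hN hfin _).2 rfl t h0 ht).2, hfin t h0⟩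

theorem ae_schwarz_lt_top (hN : 1 ≤ N) (hp0 : p ≠ 0) (hp : p ≠ ∞) (hu : MemLp u p volume) :
    ∀ᵐ x, schwarz (fun y => ENNReal.ofReal (u y)) x < ∞ := by
  -- The levels start at `1`, since only positive levels have superlevel sets of finite measure in
  -- general.
  have hlim : Tendsto (fun n : ℕ => volume {x | ((n + 1 : ℕ) : ℝ≥0∞) < ENNReal.ofReal (u x)})
      atTop (𝓝 0) := by
    have h := tendsto_measure_iInter_atTop (μ := volume)
      (s := fun n : ℕ => {x | ((n + 1 : ℕ) : ℝ≥0∞) < ENNReal.ofReal (u x)})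
      (fun n => nullMeasurableSet_lt aemeasurable_const hu.1.aemeasurable.ennreal_ofReal)
      (fun m n hmn x hx => by
        have h : ((m + 1 : ℕ) : ℝ≥0∞) ≤ ((n + 1 : ℕ) : ℝ≥0∞) := by gcongr
        exact h.trans_lt hx)
      ⟨0, (volume_lt_schwarz hN hp0 hp hu (by simp) (by simp)).2.ne⟩
    have he : ⋂ n : ℕ, {x | ((n + 1 : ℕ) : ℝ≥0∞) < ENNReal.ofReal (u x)} = ∅ := by
      refine Set.eq_empty_of_forall_notMem fun x hx => ?_
      obtain ⟨n, hn⟩ := ENNReal.exists_nat_gt (ENNReal.ofReal_ne_top (r := u x))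
      have h1 : ((n + 1 : ℕ) : ℝ≥0∞) < ENNReal.ofReal (u x) := Set.mem_iInter.1 hx n
      exact lt_asymm h1 (hn.trans_le (by simp))
    rwa [he, measure_empty] at h
  rw [ae_iff]
  refine le_antisymm (ge_of_tendsto' hlim fun n => ?_) bot_le
  rw [← (volume_lt_schwarz hN hp0 hp hu (by simp) (by simp)).1]
  refine measure_mono fun x hx => ?_
  have hx' : schwarz (fun y => ENNReal.ofReal (u y)) x = ∞ := not_lt_top_iff.1 hx
  rw [Set.mem_ofPred_eq, hx']
  exact ENNReal.natCast_lt_top _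

/-- Layer-cake formula: the norm depends only on the measures of superlevel sets of positive level.
-/
theorem eLpNorm_schwarzReal (hN : 1 ≤ N) (hp0 : p ≠ 0) (hp : p ≠ ∞) (hu : MemLp u p volume)
    (hu0 : 0 ≤ᵐ[volume] u) : eLpNorm (schwarzReal u) p volume = eLpNorm u p volume := by
  have hq : 0 < p.toReal := ENNReal.toReal_pos hp0 hp
  have hs0 : 0 ≤ᵐ[volume] schwarzReal u := Eventually.of_forall fun x => ENNReal.toReal_nonneg
  have conv : ∀ {f : EuclideanSpace ℝ (Fin N) → ℝ}, 0 ≤ᵐ[volume] f →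
      ∫⁻ x, ‖f x‖ₑ ^ p.toReal = ∫⁻ x, ENNReal.ofReal (f x ^ p.toReal) := by
    intro f hf
    refine lintegral_congr_ae ?_
    filter_upwards [hf] with x hx
    rw [enorm_rpow_eq_ofReal hq.le, abs_of_nonneg hx]
  rw [eLpNorm_eq_lintegral_rpow_enorm_toReal hp0 hp, eLpNorm_eq_lintegral_rpow_enorm_toReal hp0 hp,
    conv hs0, conv hu0,
    lintegral_rpow_eq_lintegral_meas_lt_mul _ hs0 (measurable_schwarzReal u).aemeasurable hq,
    lintegral_rpow_eq_lintegral_meas_lt_mul _ hu0 hu.1.aemeasurable hq]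
  congr 2
  refine setLIntegral_congr_fun measurableSet_Ioi fun t ht => ?_
  have ht0 : (0 : ℝ) < t := ht
  congr 1
  have h1 := (volume_lt_schwarz hN hp0 hp hu (ENNReal.ofReal_pos.2 ht0) ENNReal.ofReal_lt_top).1
  simp only [ENNReal.ofReal_lt_ofReal_iff_of_nonneg ht0.le] at h1
  rw [← h1]
  refine measure_congr ?_
  filter_upwards [ae_schwarz_lt_top hN hp0 hp hu] with x hx
  exact propext (ENNReal.ofReal_lt_iff_lt_toReal ht0.le hx.ne).symm

/-- For `t < t' < u^*(x)`, the set `{u > t'}` lies in `{g n > t} ∪ {|g n - u| ≥ t' - t}`, and the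
last set has measure tending to `0`. So `{g n > t}` eventually has more volume than the ball of
radius `‖x‖`. -/
theorem eventually_lt_schwarz {g : ℕ → EuclideanSpace ℝ (Fin N) → ℝ} (hp0 : p ≠ 0)
    (hu : AEStronglyMeasurable u) (hg : ∀ n, AEStronglyMeasurable (g n))
    (hlim : Tendsto (fun n => eLpNorm (g n - u) p volume) atTop (𝓝 0))
    (x : EuclideanSpace ℝ (Fin N)) {t : ℝ≥0∞}
    (ht : t < schwarz (fun y => ENNReal.ofReal (u y)) x) :
    ∀ᶠ n in atTop, t < schwarz (fun y => ENNReal.ofReal (g n y)) x := by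
  obtain ⟨t', htt', ht'⟩ := exists_between ht
  rw [lt_schwarz_iff] at ht'
  have hd : 0 < t' - t := tsub_pos_of_lt htt'
  have hm := tendstoInMeasure_of_tendsto_eLpNorm hp0 hg hu hlim (t' - t) hd
  have h1 := ENNReal.Tendsto.sub (tendsto_const_nhds (x := volume {y | t' < ENNReal.ofReal (u y)}))
    hm (Or.inr ENNReal.zero_ne_top)
  rw [tsub_zero] at h1
  filter_upwards [h1.eventually_const_lt ht'] with n hn
  rw [lt_schwarz_iff]
  refine hn.trans_le ?_
  rw [tsub_le_iff_right]
  refine (measure_mono fun y hy => ?_).trans (measure_union_le _ _)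
  by_contra hcon
  simp only [Set.mem_union, Set.mem_ofPred_eq, not_or, not_lt, not_le] at hcon hy
  obtain ⟨h2, h3⟩ := hcon
  have h4 : ENNReal.ofReal (u y) ≤ ENNReal.ofReal (g n y) + edist (g n y) (u y) := by
    rw [edist_comm, edist_eq_enorm_sub]
    calc ENNReal.ofReal (u y) = ENNReal.ofReal (g n y + (u y - g n y)) := by rw [add_sub_cancel]
      _ ≤ ENNReal.ofReal (g n y) + ENNReal.ofReal (u y - g n y) := ENNReal.ofReal_add_le
      _ ≤ _ := by gcongr; exact Real.ofReal_le_enorm _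
  have h5 : t' ≤ t + edist (g n y) (u y) := hy.le.trans (h4.trans (by gcongr))
  rw [add_comm, ← tsub_le_iff_right] at h5
  exact absurd h3 (not_lt.2 h5)

/-- The Schwarz symmetrization is continuous on the nonnegative functions of `L^p`. -/
theorem tendsto_eLpNorm_schwarzReal_sub {g : ℕ → EuclideanSpace ℝ (Fin N) → ℝ} (hN : 1 ≤ N)
    (hp1 : 1 ≤ p) (hp : p ≠ ∞) (hu : MemLp u p volume) (hu0 : 0 ≤ᵐ[volume] u)
    (hg : ∀ n, MemLp (g n) p volume) (hg0 : ∀ n, 0 ≤ᵐ[volume] g n)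
    (hlim : Tendsto (fun n => eLpNorm (g n - u) p volume) atTop (𝓝 0)) :
    Tendsto (fun n => eLpNorm (fun x => schwarzReal (g n) x - schwarzReal u x) p volume)
      atTop (𝓝 0) := by
  have hp0 : p ≠ 0 := (zero_lt_one.trans_le hp1).ne'
  have hq : 1 ≤ p.toReal := by
    rw [← ENNReal.toReal_one]
    exact ENNReal.toReal_mono hp hp1
  have hqp : 0 < p.toReal := by linarith
  have conv : ∀ f : EuclideanSpace ℝ (Fin N) → ℝ,
      ∫⁻ x, ‖f x‖ₑ ^ p.toReal = eLpNorm f p volume ^ p.toReal := by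
    intro f
    rw [eLpNorm_eq_lintegral_rpow_enorm_toReal hp0 hp, ← ENNReal.rpow_mul,
      one_div_mul_cancel hqp.ne', ENNReal.rpow_one]
  have hmeas : ∀ f : EuclideanSpace ℝ (Fin N) → ℝ,
      Measurable fun x => ‖schwarzReal f x‖ₑ ^ p.toReal :=
    fun f => (measurable_schwarzReal f).enorm.pow_const _
  have hnn : ∀ (f : EuclideanSpace ℝ (Fin N) → ℝ) x, 0 ≤ schwarzReal f x :=
    fun f x => ENNReal.toReal_nonneg
  have hmin : ∀ᵐ x, Tendsto (fun n => min (‖schwarzReal (g n) x‖ₑ ^ p.toReal)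
      (‖schwarzReal u x‖ₑ ^ p.toReal)) atTop (𝓝 (‖schwarzReal u x‖ₑ ^ p.toReal)) := by
    filter_upwards [ae_schwarz_lt_top hN hp0 hp hu,
      ae_all_iff.2 fun n => ae_schwarz_lt_top hN hp0 hp (hg n)] with x hx hxg
    have e : ∀ f : EuclideanSpace ℝ (Fin N) → ℝ, schwarz (fun y => ENNReal.ofReal (f y)) x < ∞ →
        ‖schwarzReal f x‖ₑ = schwarz (fun y => ENNReal.ofReal (f y)) x := fun f hf => by
      rw [Real.enorm_of_nonneg (hnn f x), schwarzReal, ENNReal.ofReal_toReal hf.ne]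
    simp only [e u hx, fun n => e (g n) (hxg n)]
    have h1 : Tendsto (fun n => min (schwarz (fun y => ENNReal.ofReal (g n y)) x)
        (schwarz (fun y => ENNReal.ofReal (u y)) x)) atTop
        (𝓝 (schwarz (fun y => ENNReal.ofReal (u y)) x)) := by
      refine tendsto_order.2 ⟨fun t ht => ?_, fun t ht => ?_⟩
      · filter_upwards [eventually_lt_schwarz hp0 hu.1 (fun n => (hg n).1) hlim x ht] with n hn
        exact lt_min hn ht
      · exact Eventually.of_forall fun n => (min_le_right _ _).trans_lt ht
    have hmono : Monotone fun s : ℝ≥0∞ => s ^ p.toReal := ENNReal.monotone_rpow_of_nonneg hqp.le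
    have h2 := (ENNReal.continuous_rpow_const (y := p.toReal)).tendsto _ |>.comp h1
    refine h2.congr fun n => ?_
    exact hmono.map_min
  have hfin : ∫⁻ x, ‖schwarzReal u x‖ₑ ^ p.toReal ≠ ∞ := by
    rw [conv, eLpNorm_schwarzReal hN hp0 hp hu hu0]
    exact ENNReal.rpow_ne_top_of_nonneg hqp.le hu.2.ne
  have hint : Tendsto (fun n => ∫⁻ x, ‖schwarzReal (g n) x‖ₑ ^ p.toReal) atTop
      (𝓝 (∫⁻ x, ‖schwarzReal u x‖ₑ ^ p.toReal)) := by
    simp only [conv, eLpNorm_schwarzReal hN hp0 hp hu hu0,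
      fun n => eLpNorm_schwarzReal hN hp0 hp (hg n) (hg0 n)]
    exact ((ENNReal.continuous_rpow_const (y := p.toReal)).tendsto _).comp
      (tendsto_eLpNorm_of_tendsto_eLpNorm_sub hp1 hu (fun n => (hg n).1) hlim)
  have h := tendsto_lintegral_sub_add_sub_of_tendsto_min (hmeas u) (fun n => hmeas (g n)) hfin
    hmin hint
  have h' : Tendsto (fun n => ∫⁻ x, ‖schwarzReal (g n) x - schwarzReal u x‖ₑ ^ p.toReal) atTop
      (𝓝 0) :=
    tendsto_of_tendsto_of_tendsto_of_le_of_le tendsto_const_nhds h (fun n => bot_le)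
      fun n => lintegral_mono fun x => enorm_sub_rpow_le hq (hnn _ x) (hnn _ x)
  have h2 := ((ENNReal.continuous_rpow_const (y := 1 / p.toReal)).tendsto _).comp h'
  rw [ENNReal.zero_rpow_of_pos (by positivity)] at h2
  refine h2.congr fun n => ?_
  rw [eLpNorm_eq_lintegral_rpow_enorm_toReal hp0 hp]
  rfl

end Schwarz

/-! ### Approximation and conclusion -/

/-- Taking the positive part of an approximant is 1-Lipschitz and leaves `u` unchanged almost
everywhere. -/
theorem MeasureTheory.MemLp.exists_hasCompactSupport_nonneg {N : ℕ} {p : ℝ≥0∞} (hp : p ≠ ∞)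
    {u : EuclideanSpace ℝ (Fin N) → ℝ} (hu : MemLp u p volume) (hu0 : 0 ≤ᵐ[volume] u) {ε : ℝ≥0∞}
    (hε : ε ≠ 0) : ∃ g : EuclideanSpace ℝ (Fin N) → ℝ, HasCompactSupport g ∧ Continuous g ∧
      (∀ x, 0 ≤ g x) ∧ MemLp g p volume ∧ eLpNorm (g - u) p volume ≤ ε := by
  obtain ⟨g, hs, hle, hc, hm⟩ := hu.exists_hasCompactSupport_eLpNorm_sub_le hp hε
  refine ⟨fun x => max (g x) 0, hs.comp_left (g := fun y => max y 0) (max_self 0),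
    hc.max continuous_const, fun x => le_max_right _ _, hm.pos_part, ?_⟩
  refine (eLpNorm_mono_ae ?_).trans hle
  filter_upwards [hu0] with x hx
  have hx' : (0 : ℝ) ≤ u x := hx
  simp only [Pi.sub_apply, Real.norm_eq_abs]
  rw [abs_sub_comm (u x)]
  conv_lhs => rw [← max_eq_left hx']
  simpa using abs_max_sub_max_le_max (g x) 0 (u x) 0

theorem theorem1 {N : ℕ} (p : ℝ≥0∞) (hp1 : 1 ≤ p) (hp : p ≠ ∞)
    (u : EuclideanSpace ℝ (Fin N) → ℝ) (hu : MemLp u p volume) (hu0 : 0 ≤ᵐ[volume] u)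
    (H : ℕ → ClosedHalfSpace N)
    (hH : ∀ n, (0 : EuclideanSpace ℝ (Fin N)) ∈ interior (H n).carrier)
    (hdense : ∀ G : ClosedHalfSpace N, (0 : EuclideanSpace ℝ (Fin N)) ∈ G.carrier →
      G ∈ closure (Set.range H)) :
    (∀ n, MemLp (polarizeSeq H u n) p volume) ∧
      MemLp (fun x => (schwarz (fun y => ENNReal.ofReal (u y)) x).toReal) p volume ∧
      Tendsto (fun n => eLpNorm (fun x => polarizeSeq H u n x -
        (schwarz (fun y => ENNReal.ofReal (u y)) x).toReal) p volume) atTop (𝓝 0) := by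
  -- Dimension `0` has no unit normal.
  have hN : 1 ≤ N := by
    by_contra hN
    obtain rfl : N = 0 := by omega
    have h := (H 0).norm_normal
    rw [Subsingleton.elim (H 0).normal 0, norm_zero] at h
    exact zero_ne_one h
  have hp0 : p ≠ 0 := (zero_lt_one.trans_le hp1).ne'
  refine ⟨hu.polarizeSeq H hp1 hp, ⟨(measurable_schwarzReal u).aestronglyMeasurable,
    (eLpNorm_schwarzReal hN hp0 hp hu hu0).trans_lt hu.2⟩, ?_⟩
  change Tendsto (fun n => eLpNorm (fun x => polarizeSeq H u n x - schwarzReal u x) p volume)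
    atTop (𝓝 0)
  have hoff : ∀ n, 0 < (H n).offset := fun n => (H n).offset_pos_of_mem_interior (hH n)
  have happrox : ∀ k : ℕ, ((k : ℝ≥0∞) + 1)⁻¹ ≠ 0 := fun k => by simp
  choose g hgs hgc hg0 hgm hgu using
    fun k : ℕ => hu.exists_hasCompactSupport_nonneg hp hu0 (happrox k)
  have hlim : Tendsto (fun k => eLpNorm (g k - u) p volume) atTop (𝓝 0) := by
    refine tendsto_of_tendsto_of_tendsto_of_le_of_le tendsto_const_nhds ?_ (fun k => bot_le) hgu
    have := (tendsto_add_atTop_iff_nat 1).2 ENNReal.tendsto_inv_nat_nhds_zero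
    simpa using this
  have hschwarz := tendsto_eLpNorm_schwarzReal_sub hN hp1 hp hu hu0 hgm
    (fun k => Eventually.of_forall (hg0 k)) hlim
  refine ENNReal.tendsto_nhds_zero.2 fun ε hε => ?_
  have hε3 : 0 < ε / 3 := ENNReal.div_pos hε.ne' (by norm_num)
  -- A single `k` controls both `g k - u` and the difference of the symmetrizations; the first bound
  -- passes to the iterates uniformly in `n`.
  obtain ⟨k, hk1, hk2⟩ := ((ENNReal.tendsto_nhds_zero.1 hlim _ hε3).and
    (ENNReal.tendsto_nhds_zero.1 hschwarz _ hε3)).exists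
  obtain ⟨R, M, δ, hgk⟩ := HasBoundsAndModulus.exists_of_hasCompactSupport (hgc k) (hgs k) (hg0 k)
  filter_upwards [ENNReal.tendsto_nhds_zero.1
    (tendsto_eLpNorm_polarizeSeq_sub_schwarzReal (p := p) hN hoff hdense hgk) _ hε3] with n hn
  have hmu := hu.1.polarizeSeq H n
  have hmg := (hgm k).1.polarizeSeq H n
  have hsu := (measurable_schwarzReal u).aestronglyMeasurable (μ := volume)
  have hsg := (measurable_schwarzReal (g k)).aestronglyMeasurable (μ := volume)
  have h1 : eLpNorm (fun x => polarizeSeq H u n x - polarizeSeq H (g k) n x) p volume ≤ ε / 3 := by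
    refine (eLpNorm_polarizeSeq_sub_le H hp1 hp hu.1 (hgm k).1 n).trans ?_
    exact (eLpNorm_sub_comm u (g k) p volume).trans_le hk1
  have e : (fun x => polarizeSeq H u n x - schwarzReal u x) =
      (fun x => polarizeSeq H u n x - polarizeSeq H (g k) n x) +
        ((fun x => polarizeSeq H (g k) n x - schwarzReal (g k) x) +
          fun x => schwarzReal (g k) x - schwarzReal u x) := by
    funext x
    simp only [Pi.add_apply]
    ring
  rw [e]
  calc _ ≤ _ := eLpNorm_add_le (hmu.sub hmg) ((hmg.sub hsg).add (hsg.sub hsu)) hp1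
    _ ≤ ε / 3 + (ε / 3 + ε / 3) := add_le_add h1
      ((eLpNorm_add_le (hmg.sub hsg) (hsg.sub hsu) hp1).trans (add_le_add hn hk2))
    _ = ε := by rw [← add_assoc, ENNReal.add_thirds]
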